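/- Let $X=(X_t)_{t\ge 0}$ be a Lévy subordinator (a nonnegative càdlàg process with $X_0=0$ and independent, stationary increments). For a random variable $W\ge 0$ put $\phi_W(u)=\mathsf{E}\,e^{-uW}$, $\Re u\ge 0$, and let $\log\phi_{X_1}$ be the continuous logarithm of $\phi_{X_1}$ on $\{\Re u\ge 0\}$ that vanishes at $u=0$ (it exists). Write $\Gamma(n,x)=\int_x^\infty y^{n-1}e^{-y}\,dy$ and $\Gamma(n)=\Gamma(n,0)$. For integers $n\ge 1$ and $t>0$ define three averages of $X$. (I) Repeated running average: $\bar X^{(0)}=X$, $\bar X^{(n)}_0=0$, $\bar X^{(n)}_t=\frac1t\int_0^t\bar X^{(n-1)}_s\,ds$. (II) Induced repeated average: $Y^{(0)}=X$, $\tilde X^{(n)}_0=0$, $\tilde X^{(n)}_t=\frac1t\int_0^t Y^{(n-1)}_s\,ds$, where, for $n\ge1$, $Y^{(n)}$ is any Lévy subordinator such that $Y^{(n)}_t$ has the same law as $\tilde X^{(n)}_t$ for every $t\ge 0$. (III) Quasi-average: $\breve X^{(n)}_t=t^{-n}$ times the $n$-fold iterated integral of $X$ from $0$ to $t$. For real $n>0$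 define, for $t>0$, $$\bar X^{(n)}_t=\frac{1}{t\,\Gamma(n)}\int_0^t X_s\log^{n-1}\frac ts\,ds,\qquad \tilde X^{(n)}_t=\int_0^1 X_{t\left(1-\Gamma(n,-\log v)/\Gamma(n)\right)}\,dv,\qquad \breve X^{(n)}_t=\frac{1}{t^n\,\Gamma(n)}\int_0^t (t-s)^{n-1}X_s\,ds.$$ **Theorem.** For all $t>0$ and $\Re u\ge 0$, and for every integer $n\ge 1$ (with the averages defined by the recipes (I)-(III)) as well as for every real $n>0$ (with the averages defined by the last display), $$\phi_{\bar X^{(n)}_t}(u)=\exp\Big(t\int_0^1\log\phi_{X_1}\Big(\Big(1-\frac{\Gamma(n,-\log s)}{\Gamma(n)}\Big)u\Big)ds\Big),$$ $$\phi_{\tilde X^{(n)}_t}(u)=\exp\Big(\frac{t}{\Gamma(n)}\int_0^1(-\log v)^{n-1}\log\phi_{X_1}(uv)\,dv\Big),$$ $$\phi_{\breve X^{(n)}_t}(u)=\exp\Big(t\int_0^1\log\phi_{X_1}\Big(\frac{s^n u}{\Gamma(n+1)}\Big)ds\Big),$$ and all integrals on the right converge. Moreover, the real-degree averages extend the recipes.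 For integers $n\ge1$, the two definitions of $\bar X^{(n)}$ agree almost surely, simultaneously for all $t>0$, and so do the two definitions of $\breve X^{(n)}$. For real $n>0$, if $Y$ is a Lévy subordinator such that $Y_t$ has the law of $\tilde X^{(n)}_t$ for every $t\ge 0$, then $\frac1t\int_0^tY_s\,ds$ has the Laplace transform of the second formula with $n+1$ in place of $n$. -/

import Mathlib

open MeasureTheory ProbabilityTheory Set Filter Topology
open scoped NNReal

universe u

/-- `f : [0,∞) → ℝ` is right-continuous with left limits. -/
def IsCadlag (f : ℝ≥0 → ℝ) : Prop :=
  ∀ t, ContinuousWithinAt f (Ici t) t ∧ ∃ l, Tendsto f (𝓝[<] t) (𝓝 l)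

/-- A Lévy subordinator: a nonnegative real-valued process started at `0`, with independent and
stationary increments and almost surely càdlàg sample paths. -/
structure IsLevySubordinator {Ω : Type u} [MeasurableSpace Ω] (P : Measure Ω)
    (X : ℝ≥0 → Ω → ℝ) : Prop where
  measurable : ∀ t, Measurable (X t)
  start_zero : ∀ᵐ ω ∂P, X 0 ω = 0
  indep_increments : HasIndepIncrements X P
  stationary_increments : ∀ s t, IdentDistrib (X (s + t) - X s) (X t) P P
  cadlag : ∀ᵐ ω ∂P, IsCadlag fun t => X t ω
  nonneg : ∀ t, ∀ᵐ ω ∂P, 0 ≤ X t ω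

/-- The Laplace transform `u ↦ E exp (-u W)` of a real random variable `W`. -/
noncomputable def laplaceTransform {Ω : Type u} [MeasurableSpace Ω] (P : Measure Ω)
    (W : Ω → ℝ) (u : ℂ) : ℂ :=
  ∫ ω, Complex.exp (-u * (W ω : ℂ)) ∂P

/-- `ψ = log φ` on the closed right half-plane, where `log φ` is the continuous logarithm of `φ`
that vanishes at the origin (such a `ψ` is unique on the half-plane). -/
structure IsContinuousLog (φ ψ : ℂ → ℂ) : Prop where
  continuousOn : ContinuousOn ψ {u | 0 ≤ u.re}
  map_zero : ψ 0 = 0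
  exp_eq : ∀ u : ℂ, 0 ≤ u.re → Complex.exp (ψ u) = φ u

/-- The upper incomplete gamma function `Γ(n, x)`. -/
noncomputable def upperGamma (n x : ℝ) : ℝ :=
  ∫ y in Ioi x, y ^ (n - 1) * Real.exp (-y)

/-- The kernel `1 - Γ(n, -log s) / Γ(n)`. -/
noncomputable def gammaKernel (n s : ℝ) : ℝ :=
  1 - upperGamma n (-Real.log s) / Real.Gamma n

/-! ### The averages of integer degree -/

/-- The running average `(1/t) ∫₀ᵗ X_s ds` (and `0` at `t = 0`). -/
noncomputable def runningAverage {Ω : Type u} (X : ℝ≥0 → Ω → ℝ) (t : ℝ≥0) (ω : Ω) : ℝ :=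
  1 / (t : ℝ) * ∫ s in (0 : ℝ)..t, X s.toNNReal ω

/-- First recipe: the `n`-fold running average of the sample paths. -/
noncomputable def repeatedAverage {Ω : Type u} (X : ℝ≥0 → Ω → ℝ) : ℕ → ℝ≥0 → Ω → ℝ
  | 0 => X
  | n + 1 => runningAverage (repeatedAverage X n)

/-- Second recipe: `IsTypeIIClock P X n Q Y` says that `Y`, living on the probability space
`(Ω', Q)`, is a type-II regulated clock of degree `n` of `X`. The clock of degree `0` is `X`; a
clock of degree `n + 1` is a Lévy subordinator with the same one-dimensional marginals as the
running average of a clock of degree `n`. -/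
inductive IsTypeIIClock {Ω : Type u} [MeasurableSpace Ω] (P : Measure Ω) (X : ℝ≥0 → Ω → ℝ) :
    ℕ → ∀ {Ω' : Type u} [MeasurableSpace Ω'], Measure Ω' → (ℝ≥0 → Ω' → ℝ) → Prop
  | zero : IsTypeIIClock P X 0 P X
  | succ {n : ℕ} {Ω₁ Ω₂ : Type u} [MeasurableSpace Ω₁] [MeasurableSpace Ω₂]
      (Q₁ : Measure Ω₁) (Q₂ : Measure Ω₂) [IsProbabilityMeasure Q₁] [IsProbabilityMeasure Q₂]
      (Y₁ : ℝ≥0 → Ω₁ → ℝ) (Y₂ : ℝ≥0 → Ω₂ → ℝ)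
      (clock : IsTypeIIClock P X n Q₁ Y₁) (levy : IsLevySubordinator Q₂ Y₂)
      (marginals : ∀ t, IdentDistrib (Y₂ t) (runningAverage Y₁ t) Q₂ Q₁) :
      IsTypeIIClock P X (n + 1) Q₂ Y₂

/-- The `n`-fold iterated integral of the sample paths from `0` to `t`. -/
noncomputable def iteratedIntegral {Ω : Type u} (X : ℝ≥0 → Ω → ℝ) : ℕ → ℝ≥0 → Ω → ℝ
  | 0 => X
  | n + 1 => fun t ω => ∫ s in (0 : ℝ)..t, iteratedIntegral X n s.toNNReal ω

/-- Third recipe: the quasi-average `t⁻ⁿ ∫₀ᵗ ⋯ ∫₀ X_s ds ⋯ ds` (`n`-fold). -/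
noncomputable def quasiAverage {Ω : Type u} (X : ℝ≥0 → Ω → ℝ) (n : ℕ) (t : ℝ≥0) (ω : Ω) : ℝ :=
  1 / (t : ℝ) ^ n * iteratedIntegral X n t ω

/-! ### The averages of real degree `n > 0` -/

/-- Type I: `(1 / (t Γ(n))) ∫₀ᵗ X_s log^{n-1}(t/s) ds`. -/
noncomputable def fracAverageI {Ω : Type u} (X : ℝ≥0 → Ω → ℝ) (n : ℝ) (t : ℝ≥0) (ω : Ω) : ℝ :=
  1 / ((t : ℝ) * Real.Gamma n) *
    ∫ s in (0 : ℝ)..t, X s.toNNReal ω * Real.log (t / s) ^ (n - 1)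

/-- Type II: `∫₀¹ X_{t k(v)} dv` with `k(v) = 1 - Γ(n, -log v) / Γ(n)`. For `n = 1` this is the
running average. -/
noncomputable def fracAverageII {Ω : Type u} (X : ℝ≥0 → Ω → ℝ) (n : ℝ) (t : ℝ≥0) (ω : Ω) : ℝ :=
  ∫ v in (0 : ℝ)..1, X ((t : ℝ) * gammaKernel n v).toNNReal ω

/-- Type III: the scaled Riemann-Liouville integral
`(1 / (tⁿ Γ(n))) ∫₀ᵗ (t - s)^{n-1} X_s ds`. -/
noncomputable def fracAverageIII {Ω : Type u} (X : ℝ≥0 → Ω → ℝ) (n : ℝ) (t : ℝ≥0) (ω : Ω) : ℝ :=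
  1 / ((t : ℝ) ^ n * Real.Gamma n) *
    ∫ s in (0 : ℝ)..t, ((t : ℝ) - s) ^ (n - 1) * X s.toNNReal ω

/-! ### The three log-Laplace exponents, for `ψ = log φ` -/

/-- The integrand of the type-I exponent. -/
noncomputable def integrandI (ψ : ℂ → ℂ) (n : ℝ) (u : ℂ) (s : ℝ) : ℂ :=
  ψ ((gammaKernel n s : ℂ) * u)

/-- The integrand of the type-II exponent, without the factor `1 / Γ(n)`. -/
noncomputable def integrandII (ψ : ℂ → ℂ) (n : ℝ) (u : ℂ) (v : ℝ) : ℂ :=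
  (((-Real.log v) ^ (n - 1) : ℝ) : ℂ) * ψ (u * (v : ℂ))

/-- The integrand of the type-III exponent. -/
noncomputable def integrandIII (ψ : ℂ → ℂ) (n : ℝ) (u : ℂ) (s : ℝ) : ℂ :=
  ψ (((s ^ n : ℝ) : ℂ) * u / (Real.Gamma (n + 1) : ℂ))

/-- `exp (t ∫₀¹ ψ((1 - Γ(n, -log s) / Γ(n)) u) ds)`. -/
noncomputable def formulaI (ψ : ℂ → ℂ) (n : ℝ) (t : ℝ≥0) (u : ℂ) : ℂ :=
  Complex.exp ((t : ℝ) * ∫ s in (0 : ℝ)..1, integrandI ψ n u s)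

/-- `exp ((t / Γ(n)) ∫₀¹ (-log v)^{n-1} ψ(u v) dv)`. -/
noncomputable def formulaII (ψ : ℂ → ℂ) (n : ℝ) (t : ℝ≥0) (u : ℂ) : ℂ :=
  Complex.exp (((t : ℝ) / Real.Gamma n : ℝ) * ∫ v in (0 : ℝ)..1, integrandII ψ n u v)

/-- `exp (t ∫₀¹ ψ(sⁿ u / Γ(n+1)) ds)`. -/
noncomputable def formulaIII (ψ : ℂ → ℂ) (n : ℝ) (t : ℝ≥0) (u : ℂ) : ℂ :=
  Complex.exp ((t : ℝ) * ∫ s in (0 : ℝ)..1, integrandIII ψ n u s)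

/-! ### Laplace transforms of nonnegative random variables -/

/-! All three families are instances of one formula, `laplaceTransform_integral`. For a finite
measure `μ` on `[0,1]`, the variable `∫ X_{ts} μ(ds)` equals, after summation by parts, the integral
of the tail `μ((s,1])` against the increments of `s ↦ X_{ts}`. On a regular grid this is a weighted
sum of independent increments, so its Laplace transform is the exponential of a Riemann sum of
`tψ(μ((s,1])u)`. The tail is monotone, hence continuous off a countable set, and the Riemann sums
converge to the integral.

It remains to identify `μ` and its tail. Let `k` be the gamma kernel, a decreasing bijection of
`(0,1)` whose derivative is minus the log-gamma density. For type I, `μ` has that density and its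
tail is `k`. For type II, `μ` is the image of Lebesgue measure under `k`; its tail is the inverse of
`k`, and the substitution `s = k(v)` brings the density back. For type III, the density is
`(1-s)^{n-1}/Γ(n)`, with an explicit power as tail.

The recipes reduce to the real-degree averages. If `V` has the log-gamma law of degree `n` and `U`
is independent and uniform, then `UV` has the law of degree `n+1`: a gamma variable plus an
independent exponential one (`map_mul_logGamma_prod`). Applied to paths, this gives the repeated
averages; applied to exponents, the type-II recursion. The quasi-averages come from Cauchy's formula
for repeated integration.

Underneath lies the identity `E exp(-uX_t) = exp(tψ(u))` with `ψ` continuous. For fixed `u` the left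
side is a continuous semigroup in `t`, and its generator has an explicit expression that is
continuous in `u`. -/

theorem norm_cexp_neg_mul_le_one {u : ℂ} (hu : 0 ≤ u.re) {x : ℝ} (hx : 0 ≤ x) :
    ‖Complex.exp (-u * (x : ℂ))‖ ≤ 1 := by
  rw [Complex.norm_exp]
  simp only [neg_mul, Complex.neg_re, Complex.mul_re, Complex.ofReal_re, Complex.ofReal_im,
    mul_zero, sub_zero]
  exact Real.exp_le_one_iff.2 (by nlinarith [mul_nonneg hu hx])

section Laplace

variable {Ω : Type u} [MeasurableSpace Ω] {P : Measure Ω}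

theorem laplaceTransform_congr {V W : Ω → ℝ} (h : V =ᵐ[P] W) (u : ℂ) :
    laplaceTransform P V u = laplaceTransform P W u := by
  refine integral_congr_ae ?_
  filter_upwards [h] with ω hω
  rw [hω]

theorem laplaceTransform_identDistrib {Ω' : Type u} [MeasurableSpace Ω'] {Q : Measure Ω'}
    {V : Ω → ℝ} {W : Ω' → ℝ} (h : IdentDistrib V W P Q) (u : ℂ) :
    laplaceTransform P V u = laplaceTransform Q W u := by
  have hm : Measurable fun x : ℝ => Complex.exp (-u * (x : ℂ)) := by fun_prop
  exact (h.comp hm).integral_eq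

theorem laplaceTransform_add {V W : Ω → ℝ} (h : IndepFun V W P) (hV : AEMeasurable V P)
    (hW : AEMeasurable W P) (u : ℂ) :
    laplaceTransform P (V + W) u = laplaceTransform P V u * laplaceTransform P W u := by
  have hm : Measurable fun x : ℝ => Complex.exp (-u * (x : ℂ)) := by fun_prop
  have := (h.comp hm hm).integral_fun_mul_eq_mul_integral
    (hm.comp_aemeasurable hV).aestronglyMeasurable
    (hm.comp_aemeasurable hW).aestronglyMeasurable
  simp only [laplaceTransform]
  rw [show (fun ω => Complex.exp (-u * (((V + W) ω : ℝ) : ℂ))) = fun ω =>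
    Complex.exp (-u * (V ω : ℂ)) * Complex.exp (-u * (W ω : ℂ)) from ?_]
  · exact this
  · funext ω
    rw [← Complex.exp_add]
    congr 1
    simp only [Pi.add_apply]
    push_cast
    ring

variable [IsProbabilityMeasure P]

theorem laplaceTransform_zero_right (W : Ω → ℝ) : laplaceTransform P W 0 = 1 := by
  simp [laplaceTransform]

theorem norm_laplaceTransform_le_one {W : Ω → ℝ} (hW : ∀ᵐ ω ∂P, 0 ≤ W ω) {u : ℂ}
    (hu : 0 ≤ u.re) : ‖laplaceTransform P W u‖ ≤ 1 := by
  have := norm_integral_le_of_norm_le_const (μ := P) (C := 1)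
    (f := fun ω => Complex.exp (-u * (W ω : ℂ)))
    (by filter_upwards [hW] with ω hω using norm_cexp_neg_mul_le_one hu hω)
  simpa [laplaceTransform] using this

theorem continuousOn_laplaceTransform {W : Ω → ℝ} (hm : AEMeasurable W P)
    (hW : ∀ᵐ ω ∂P, 0 ≤ W ω) :
    ContinuousOn (laplaceTransform P W) {u | 0 ≤ u.re} := by
  refine continuousOn_of_dominated (bound := fun _ => 1) ?_ ?_ (integrable_const _) ?_
  · intro u _
    have h : Measurable fun x : ℝ => Complex.exp (-u * (x : ℂ)) := by fun_prop
    exact (h.comp_aemeasurable hm).aestronglyMeasurable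
  · intro u hu
    filter_upwards [hW] with ω hω using norm_cexp_neg_mul_le_one hu hω
  · filter_upwards with ω
    fun_prop

/-- Laplace transforms are continuous under almost sure convergence of nonnegative variables. -/
theorem tendsto_laplaceTransform {ι : Type*} {l : Filter ι} [l.IsCountablyGenerated]
    {V : ι → Ω → ℝ} {W : Ω → ℝ} (hm : ∀ i, AEMeasurable (V i) P)
    (hV : ∀ᶠ i in l, ∀ᵐ ω ∂P, 0 ≤ V i ω)
    (h : ∀ᵐ ω ∂P, Tendsto (fun i => V i ω) l (𝓝 (W ω))) {u : ℂ} (hu : 0 ≤ u.re) :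
    Tendsto (fun i => laplaceTransform P (V i) u) l (𝓝 (laplaceTransform P W u)) := by
  refine tendsto_integral_filter_of_dominated_convergence (fun _ => 1) ?_ ?_
    (integrable_const _) ?_
  · refine Eventually.of_forall fun i => ?_
    have h : Measurable fun x : ℝ => Complex.exp (-u * (x : ℂ)) := by fun_prop
    exact (h.comp_aemeasurable (hm i)).aestronglyMeasurable
  · filter_upwards [hV] with i hi
    filter_upwards [hi] with ω hω using norm_cexp_neg_mul_le_one hu hω
  · filter_upwards [h] with ω hω
    have h : Continuous fun x : ℝ => Complex.exp (-u * (x : ℂ)) := by fun_prop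
    exact (h.tendsto _).comp hω

end Laplace

/-! ### Continuous one-parameter semigroups of complex numbers -/

/-- Integrating `g(t+s) = g(t)g(s)` over `s ∈ [0,h]` expresses `g` through its primitive, so a
continuous `g` is automatically differentiable and solves `g' = cg`. The explicit value of `c` is
what later gives continuity of the exponent in `u`. -/
theorem semigroup_eq_exp {g : ℝ → ℂ} (hg : Continuous g) (h0 : g 0 = 1)
    (hadd : ∀ s t : ℝ, 0 ≤ s → 0 ≤ t → g (s + t) = g s * g t) {h : ℝ} (hh : 0 ≤ h)
    (hne : ∫ s in (0 : ℝ)..h, g s ≠ 0) {t : ℝ} (ht : 0 ≤ t) :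
    g t = Complex.exp (t * ((g h - 1) / ∫ s in (0 : ℝ)..h, g s)) := by
  set I := ∫ s in (0 : ℝ)..h, g s with hI
  set c := (g h - 1) / I with hc
  set G : ℝ → ℂ := fun t => ∫ s in (0 : ℝ)..t, g s with hG
  have hGd : ∀ t, HasDerivAt G (g t) t := fun t => hg.integral_hasStrictDerivAt 0 t |>.hasDerivAt
  have hgG : ∀ t, 0 ≤ t → g t = (G (t + h) - G t) / I := by
    intro t ht
    rw [eq_div_iff hne]
    have h1 : G (t + h) - G t = ∫ s in t..(t + h), g s :=
      intervalIntegral.integral_interval_sub_left (hg.intervalIntegrable _ _)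
        (hg.intervalIntegrable _ _)
    rw [h1, hI, ← intervalIntegral.integral_const_mul]
    have h2 : ∫ s in t..(t + h), g s = ∫ s in (0 : ℝ)..h, g (t + s) := by
      rw [intervalIntegral.integral_comp_add_left]
      simp
    rw [h2]
    refine intervalIntegral.integral_congr fun s hs => ?_
    rw [uIcc_of_le hh] at hs
    exact (hadd t s ht hs.1).symm
  have hd : ∀ t, 0 ≤ t → HasDerivWithinAt g (c * g t) (Ici t) t := by
    intro t ht
    have h1 : HasDerivAt (fun t => (G (t + h) - G t) / I) ((g (t + h) - g t) / I) t :=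
      (((hGd (t + h)).comp_add_const t h).sub (hGd t)).div_const I
    have h2 : (g (t + h) - g t) / I = c * g t := by
      rw [hadd t h ht hh, hc]
      ring
    rw [← h2]
    exact h1.hasDerivWithinAt.congr (fun x hx => hgG x (ht.trans hx)) (hgG t ht)
  have hconst : ∀ x ∈ Icc (0 : ℝ) t, g x * Complex.exp (-(x * c)) = g 0 * Complex.exp (-((0 : ℝ) * c)) := by
    refine constant_of_has_deriv_right_zero (by fun_prop) fun x hx => ?_
    have h1 : HasDerivAt (fun x : ℝ => Complex.exp (-(x * c))) (Complex.exp (-(x * c)) * (-(1 * c))) x := by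
      have : HasDerivAt (fun x : ℝ => -((x : ℂ) * c)) (-(1 * c)) x :=
        (Complex.ofRealCLM.hasDerivAt.mul_const c).neg
      exact this.cexp
    have h2 := (hd x hx.1).mul h1.hasDerivWithinAt (s := Ici x)
    exact HasDerivWithinAt.congr_deriv h2 (by ring)
  have := hconst t ⟨ht, le_rfl⟩
  rw [h0] at this
  simp only [Complex.ofReal_zero, zero_mul, neg_zero, Complex.exp_zero, mul_one] at this
  rw [Complex.exp_neg, mul_inv_eq_one₀ (Complex.exp_ne_zero _)] at this
  exact this

theorem exists_integral_ne_zero {g : ℝ → ℂ} (hg : Continuous g) (h0 : g 0 = 1) :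
    ∃ h : ℝ, 0 < h ∧ ∫ s in (0 : ℝ)..h, g s ≠ 0 := by
  have hd : HasDerivAt (fun t : ℝ => ∫ s in (0 : ℝ)..t, g s) (g 0) 0 :=
    (hg.integral_hasStrictDerivAt 0 0).hasDerivAt
  have h1 := hd.eventually_ne (c := 0) (by simp [h0])
  have h2 : ∀ᶠ t in 𝓝[>] (0 : ℝ), ∫ s in (0 : ℝ)..t, g s ≠ 0 :=
    h1.filter_mono (nhdsWithin_mono _ fun x hx => ne_of_gt hx)
  obtain ⟨h, hh, hpos⟩ := (h2.and self_mem_nhdsWithin).exists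
  exact ⟨h, hpos, hh⟩

/-- Characterises the exponent without reference to `h`, so that the expressions obtained from
different `h` can be compared. -/
theorem derivWithin_exp_mul_zero {g : ℝ → ℂ} {c : ℂ}
    (hg : ∀ t : ℝ, 0 ≤ t → g t = Complex.exp (t * c)) : derivWithin g (Ici 0) 0 = c := by
  have h1 : HasDerivAt (fun x : ℝ => Complex.exp (x * c)) (Complex.exp ((0 : ℝ) * c) * (1 * c)) 0 :=
    (Complex.ofRealCLM.hasDerivAt.mul_const c).cexp
  have h2 : HasDerivWithinAt g c (Ici 0) 0 := by
    have := h1.hasDerivWithinAt (s := Ici 0) |>.congr (fun x hx => hg x hx) (hg 0 le_rfl)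
    simpa using this
  exact h2.derivWithin (uniqueDiffOn_Ici 0 0 self_mem_Ici)

/-! ### Uniqueness of the continuous logarithm -/

theorem convex_re_nonneg : Convex ℝ {u : ℂ | 0 ≤ u.re} :=
  convex_halfSpace_re_ge 0

/-- The difference divided by `2πi` is continuous and integer-valued on a connected set, hence
constant, and it vanishes at the origin. -/
theorem IsContinuousLog.eqOn {φ ψ₁ ψ₂ : ℂ → ℂ} (h₁ : IsContinuousLog φ ψ₁)
    (h₂ : IsContinuousLog φ ψ₂) : EqOn ψ₁ ψ₂ {u | 0 ≤ u.re} := by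
  have hint : ∀ u ∈ {u : ℂ | 0 ≤ u.re}, ∃ k : ℤ,
      (ψ₁ u - ψ₂ u) / (2 * Real.pi * Complex.I) = k := by
    intro u hu
    obtain ⟨k, hk⟩ := Complex.exp_eq_exp_iff_exists_int.1
      ((h₁.exp_eq u hu).trans (h₂.exp_eq u hu).symm)
    refine ⟨k, ?_⟩
    rw [hk, add_sub_cancel_left, mul_div_assoc, div_self Complex.two_pi_I_ne_zero, mul_one]
  have hcont : ContinuousOn (fun u => ((ψ₁ u - ψ₂ u) / (2 * Real.pi * Complex.I)).re)
      {u : ℂ | 0 ≤ u.re} :=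
    Complex.continuous_re.comp_continuousOn ((h₁.continuousOn.sub h₂.continuousOn).div_const _)
  have hcst : ∀ u ∈ {u : ℂ | 0 ≤ u.re},
      ((ψ₁ u - ψ₂ u) / (2 * Real.pi * Complex.I)).re = 0 := by
    intro u hu
    have hT : MapsTo (fun u => ((ψ₁ u - ψ₂ u) / (2 * Real.pi * Complex.I)).re)
        {u : ℂ | 0 ≤ u.re} (range ((↑) : ℤ → ℝ)) := by
      intro v hv
      obtain ⟨k, hk⟩ := hint v hv
      exact ⟨k, by simp [hk]⟩
    have h0 : (0 : ℂ) ∈ {u : ℂ | 0 ≤ u.re} := by simp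
    have := convex_re_nonneg.isPreconnected.constant_of_mapsTo
      Int.isClosedEmbedding_coe_real.isEmbedding.isDiscrete_range hcont hT hu h0
    rw [this, h₁.map_zero, h₂.map_zero]
    simp
  intro u hu
  obtain ⟨k, hk⟩ := hint u hu
  have h0 := hcst u hu
  rw [hk] at h0
  have hk0 : (ψ₁ u - ψ₂ u) / (2 * Real.pi * Complex.I) = 0 := by
    rw [hk]
    have : k = 0 := by exact_mod_cast h0
    simp [this]
  rw [div_eq_zero_iff] at hk0
  exact sub_eq_zero.1 (hk0.resolve_right Complex.two_pi_I_ne_zero)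

/-! ### Lévy subordinators -/

/-- A function on `[0,∞)` that is right-continuous and monotone along a dense set is monotone. -/
theorem monotone_of_rightContinuous {f : ℝ≥0 → ℝ}
    (hf : ∀ t, ContinuousWithinAt f (Ici t) t) {D : Set ℝ≥0} (hD : Dense D)
    (hmono : ∀ s ∈ D, ∀ t ∈ D, s ≤ t → f s ≤ f t) : Monotone f := by
  have key : ∀ (t b : ℝ≥0) (U : Set ℝ), t < b → U ∈ 𝓝 (f t) → ∃ q ∈ D, t < q ∧ q < b ∧ f q ∈ U := by
    intro t b U htb hU
    have h1 : f ⁻¹' U ∈ 𝓝[≥] t := hf t hU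
    obtain ⟨c, hc, hcU⟩ := (mem_nhdsGE_iff_exists_Ico_subset' htb).1 h1
    obtain ⟨q, hqD, hq⟩ := hD.exists_between (lt_min hc htb)
    exact ⟨q, hqD, hq.1, hq.2.trans_le (min_le_right _ _),
      hcU ⟨hq.1.le, hq.2.trans_le (min_le_left _ _)⟩⟩
  intro s t hst
  rcases hst.eq_or_lt with rfl | hst
  · exact le_rfl
  by_contra! hlt
  obtain ⟨c, hc1, hc2⟩ := exists_between hlt
  obtain ⟨q, hqD, hq1, hq2, hq3⟩ := key s t (Ioi c) hst (Ioi_mem_nhds hc2)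
  obtain ⟨r, hrD, hr1, -, hr3⟩ := key t (t + 1) (Iio c) (by simp) (Iio_mem_nhds hc1)
  exact absurd (hmono q hqD r hrD (hq2.trans hr1).le) (not_le.2 (lt_trans hr3 hq3))

namespace IsLevySubordinator

variable {Ω : Type u} [MeasurableSpace Ω] {P : Measure Ω} {X : ℝ≥0 → Ω → ℝ}

theorem ae_le (hX : IsLevySubordinator P X) {s t : ℝ≥0} (hst : s ≤ t) :
    ∀ᵐ ω ∂P, X s ω ≤ X t ω := by
  obtain ⟨r, rfl⟩ := exists_add_of_le hst
  have h := (hX.stationary_increments s r).symm.ae_snd (p := fun x => 0 ≤ x)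
    measurableSet_Ici (hX.nonneg r)
  filter_upwards [h] with ω hω
  simpa using hω

/-- Increments are nonnegative because they have the law of some `X r`. A countable dense set of
times needs only one null set, and right-continuity covers the remaining times. -/
theorem ae_monotone (hX : IsLevySubordinator P X) : ∀ᵐ ω ∂P, Monotone fun t => X t ω := by
  obtain ⟨D, hDc, hD⟩ := TopologicalSpace.exists_countable_dense ℝ≥0
  have h : ∀ᵐ ω ∂P, ∀ s ∈ D, ∀ t ∈ D, s ≤ t → X s ω ≤ X t ω := by
    refine (ae_ball_iff hDc).2 fun s _ => (ae_ball_iff hDc).2 fun t _ => ?_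
    by_cases hst : s ≤ t
    · filter_upwards [hX.ae_le hst] with ω hω using fun _ => hω
    · exact Eventually.of_forall fun ω h => absurd h hst
  filter_upwards [h, hX.cadlag] with ω h1 h2
  exact monotone_of_rightContinuous (fun t => (h2 t).1) hD h1

theorem ae_rightContinuous (hX : IsLevySubordinator P X) :
    ∀ᵐ ω ∂P, ∀ t, ContinuousWithinAt (fun t => X t ω) (Ici t) t := by
  filter_upwards [hX.cadlag] with ω h t using (h t).1

theorem laplaceTransform_add (hX : IsLevySubordinator P X) (s t : ℝ≥0) (u : ℂ) :
    laplaceTransform P (X (s + t)) u = laplaceTransform P (X s) u * laplaceTransform P (X t) u := by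
  have hind : IndepFun (X s) (X (s + t) - X s) P :=
    hX.indep_increments.indepFun_eval_sub (by simp) le_self_add hX.start_zero
  rw [← laplaceTransform_identDistrib (hX.stationary_increments s t) u,
    ← _root_.laplaceTransform_add hind (hX.measurable s).aemeasurable
      ((hX.measurable _).sub (hX.measurable s)).aemeasurable]
  simp

variable [IsProbabilityMeasure P]

theorem laplaceTransform_at_zero (hX : IsLevySubordinator P X) (u : ℂ) :
    laplaceTransform P (X 0) u = 1 := by
  rw [laplaceTransform_congr (W := fun _ => 0) hX.start_zero]
  simp [laplaceTransform]

/-- The semigroup property and the bound `‖φ‖ ≤ 1` reduce continuity everywhere to continuity at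
time `0`, which is right-continuity of the paths there. -/
theorem continuous_laplaceTransform_time (hX : IsLevySubordinator P X) {u : ℂ} (hu : 0 ≤ u.re) :
    Continuous fun t : ℝ≥0 => laplaceTransform P (X t) u := by
  have h0 : Tendsto (fun t : ℝ≥0 => laplaceTransform P (X t) u) (𝓝 0) (𝓝 1) := by
    rw [← hX.laplaceTransform_at_zero u]
    refine tendsto_laplaceTransform (fun t => (hX.measurable t).aemeasurable)
      (Eventually.of_forall hX.nonneg) ?_ hu
    filter_upwards [hX.ae_rightContinuous] with ω hω
    have := hω 0
    rwa [ContinuousWithinAt, show Ici (0 : ℝ≥0) = univ from by ext; simp, nhdsWithin_univ] at this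
  have hle : ∀ s t : ℝ≥0, s ≤ t → dist (laplaceTransform P (X s) u) (laplaceTransform P (X t) u) ≤
      dist (laplaceTransform P (X (t - s)) u) 1 := by
    intro s t hst
    obtain ⟨r, rfl⟩ := exists_add_of_le hst
    rw [add_tsub_cancel_left, hX.laplaceTransform_add, dist_comm, dist_eq_norm, dist_eq_norm]
    calc _ = ‖laplaceTransform P (X s) u * (laplaceTransform P (X r) u - 1)‖ := by
          congr 1
          ring
      _ ≤ 1 * ‖laplaceTransform P (X r) u - 1‖ := by
          rw [norm_mul]
          gcongr
          exact norm_laplaceTransform_le_one (hX.nonneg s) hu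
      _ = _ := one_mul _
  rw [Metric.continuous_iff]
  intro t ε hε
  obtain ⟨δ, hδ, h⟩ := Metric.tendsto_nhds_nhds.1 h0 ε hε
  refine ⟨δ, hδ, fun s hst => ?_⟩
  rcases le_total s t with hle' | hle'
  · refine (hle s t hle').trans_lt (h ?_)
    rw [NNReal.dist_eq] at hst ⊢
    rw [NNReal.coe_sub hle']
    rw [abs_sub_comm] at hst
    simpa using hst
  · rw [dist_comm]
    refine (hle t s hle').trans_lt (h ?_)
    rw [NNReal.dist_eq] at hst ⊢
    rw [NNReal.coe_sub hle']
    simpa using hst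

/-- The Laplace exponent of a Lévy subordinator. -/
theorem exists_laplaceExponent (hX : IsLevySubordinator P X) :
    ∃ ψ : ℂ → ℂ, IsContinuousLog (laplaceTransform P (X 1)) ψ ∧
      ∀ u : ℂ, 0 ≤ u.re → ∀ t : ℝ≥0,
        laplaceTransform P (X t) u = Complex.exp ((t : ℝ) * ψ u) := by
  set g : ℂ → ℝ → ℂ := fun u t => laplaceTransform P (X t.toNNReal) u with hg
  have hgc : ∀ u : ℂ, 0 ≤ u.re → Continuous (g u) := fun u hu =>
    (hX.continuous_laplaceTransform_time hu).comp continuous_real_toNNReal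
  have hg0 : ∀ u, g u 0 = 1 := fun u => by simp [hg, hX.laplaceTransform_at_zero]
  have hadd : ∀ u, ∀ s t : ℝ, 0 ≤ s → 0 ≤ t → g u (s + t) = g u s * g u t := by
    intro u s t hs ht
    simp only [hg, Real.toNNReal_add hs ht, hX.laplaceTransform_add]
  set ψ : ℂ → ℂ := fun u => derivWithin (g u) (Ici 0) 0 with hψ
  have hform : ∀ u : ℂ, 0 ≤ u.re → ∀ h : ℝ, 0 ≤ h → ∫ s in (0 : ℝ)..h, g u s ≠ 0 →
      ψ u = (g u h - 1) / ∫ s in (0 : ℝ)..h, g u s := fun u hu h hh hne =>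
    derivWithin_exp_mul_zero fun t ht =>
      semigroup_eq_exp (hgc u hu) (hg0 u) (hadd u) hh hne ht
  have hexp : ∀ u : ℂ, 0 ≤ u.re → ∀ t : ℝ≥0,
      laplaceTransform P (X t) u = Complex.exp ((t : ℝ) * ψ u) := by
    intro u hu t
    obtain ⟨h, hh, hne⟩ := exists_integral_ne_zero (hgc u hu) (hg0 u)
    rw [hform u hu h hh.le hne,
      ← semigroup_eq_exp (hgc u hu) (hg0 u) (hadd u) hh.le hne t.coe_nonneg]
    simp [hg]
  -- An `h` chosen for `u` still gives a nonzero integral for all nearby `v`, so `ψ` is locally one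
  -- quotient of continuous functions.
  have hcont : ContinuousOn ψ {u | 0 ≤ u.re} := by
    intro u hu
    obtain ⟨h, hh, hne⟩ := exists_integral_ne_zero (hgc u hu) (hg0 u)
    have hI : ContinuousWithinAt (fun v => ∫ s in (0 : ℝ)..h, g v s) {u | 0 ≤ u.re} u := by
      refine intervalIntegral.continuousWithinAt_of_dominated_interval (bound := fun _ => 1) ?_ ?_
        intervalIntegrable_const ?_
      · filter_upwards [self_mem_nhdsWithin] with v hv
        exact (hgc v hv).aestronglyMeasurable
      · filter_upwards [self_mem_nhdsWithin] with v hv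
        exact Eventually.of_forall fun t _ => norm_laplaceTransform_le_one (hX.nonneg _) hv
      · exact Eventually.of_forall fun t _ =>
          continuousOn_laplaceTransform (hX.measurable _).aemeasurable (hX.nonneg _) u hu
    have hN : ContinuousWithinAt (fun v => g v h - 1) {u | 0 ≤ u.re} u :=
      (continuousOn_laplaceTransform (hX.measurable _).aemeasurable (hX.nonneg _) u hu).sub
        continuousWithinAt_const
    refine (hN.div hI hne).congr_of_eventuallyEq ?_ (hform u hu h hh.le hne)
    filter_upwards [hI.eventually_ne hne, self_mem_nhdsWithin] with v hv1 hv2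
    exact hform v hv2 h hh.le hv1
  refine ⟨ψ, ⟨hcont, ?_, fun u hu => ?_⟩, hexp⟩
  · have h1 : g 0 = fun _ => 1 := by
      funext t
      exact laplaceTransform_zero_right _
    simp [hψ, h1]
  · rw [hexp u hu 1]
    simp

theorem laplaceTransform_eq_exp (hX : IsLevySubordinator P X) {ψ : ℂ → ℂ}
    (hψ : IsContinuousLog (laplaceTransform P (X 1)) ψ) (t : ℝ≥0) {u : ℂ} (hu : 0 ≤ u.re) :
    laplaceTransform P (X t) u = Complex.exp ((t : ℝ) * ψ u) := by
  obtain ⟨ψ', h1, h2⟩ := hX.exists_laplaceExponent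
  rw [h2 u hu t, hψ.eqOn h1 hu]

end IsLevySubordinator

/-! ### Riemann sums -/

/-- Rewriting a Riemann sum as the integral of a step function makes dominated convergence
available. -/
theorem sum_range_eq_intervalIntegral_floor {E : Type*} [NormedAddCommGroup E] [NormedSpace ℝ E]
    [CompleteSpace E] (f : ℝ → E) {K : ℕ} (hK : K ≠ 0) :
    ∑ j ∈ Finset.range K, (1 / (K : ℝ)) • f (j / K) =
      ∫ s in (0 : ℝ)..1, f (⌊(K : ℝ) * s⌋₊ / K) := by
  have hK' : (K : ℝ) ≠ 0 := by exact_mod_cast hK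
  have hae : ∀ k : ℕ, ∀ᵐ x : ℝ ∂volume, x ∈ uIoc (k : ℝ) ((k + 1 : ℕ) : ℝ) →
      f (k / K) = f (⌊x⌋₊ / K) := by
    intro k
    have h1 : ∀ᵐ x : ℝ ∂volume, x ≠ ((k + 1 : ℕ) : ℝ) := by
      simp [ae_iff]
    filter_upwards [h1] with x hx1 hx2
    rw [uIoc_of_le (by simp)] at hx2
    have : ⌊x⌋₊ = k := by
      rw [Nat.floor_eq_iff ((Nat.cast_nonneg k).trans hx2.1.le)]
      exact ⟨hx2.1.le, by simpa using lt_of_le_of_ne hx2.2 hx1⟩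
    rw [this]
  have hint : ∀ k < K, IntervalIntegrable (fun x : ℝ => f (⌊x⌋₊ / K)) volume
      ((fun k : ℕ => (k : ℝ)) k) ((fun k : ℕ => (k : ℝ)) (k + 1)) := by
    intro k _
    refine (intervalIntegrable_const (c := f (k / K))).congr_ae ?_
    rw [Filter.EventuallyEq, ae_restrict_iff' measurableSet_uIoc]
    exact hae k
  have h := intervalIntegral.sum_integral_adjacent_intervals hint
  have h2 := intervalIntegral.integral_comp_mul_left (a := 0) (b := 1)
    (fun x : ℝ => f (⌊x⌋₊ / K)) hK'
  rw [h2, mul_zero, mul_one, ← Finset.smul_sum, one_div]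
  congr 1
  simp only [Nat.cast_zero] at h
  rw [← h]
  refine Finset.sum_congr rfl fun k _ => ?_
  rw [← intervalIntegral.integral_congr_ae (hae k)]
  simp

theorem tendsto_floor_mul_div (s : ℝ) (hs : 0 ≤ s) :
    Tendsto (fun n : ℕ => (⌊((n + 1 : ℕ) : ℝ) * s⌋₊ : ℝ) / ((n + 1 : ℕ) : ℝ)) atTop (𝓝 s) := by
  have h := (tendsto_nat_floor_mul_div_atTop hs).comp
    (tendsto_natCast_atTop_atTop.comp (tendsto_add_atTop_nat 1))
  refine h.congr fun n => ?_
  simp [mul_comm]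

theorem tendsto_ceil_mul_div (s : ℝ) (hs : 0 ≤ s) :
    Tendsto (fun n : ℕ => (⌈((n + 1 : ℕ) : ℝ) * s⌉₊ : ℝ) / ((n + 1 : ℕ) : ℝ)) atTop (𝓝 s) := by
  have h := (tendsto_nat_ceil_mul_div_atTop hs).comp
    (tendsto_natCast_atTop_atTop.comp (tendsto_add_atTop_nat 1))
  refine h.congr fun n => ?_
  simp [mul_comm]

/-- Riemann sums of a bounded, almost everywhere continuous function converge. -/
theorem tendsto_riemannSum {E : Type*} [NormedAddCommGroup E] [NormedSpace ℝ E]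
    [CompleteSpace E] {f : ℝ → E} {C : ℝ} (hC : ∀ s, ‖f s‖ ≤ C)
    (hf : ∀ᵐ s ∂volume, ContinuousAt f s) :
    Tendsto (fun n : ℕ => ∑ j ∈ Finset.range (n + 1),
      (1 / ((n + 1 : ℕ) : ℝ)) • f (j / ((n + 1 : ℕ) : ℝ))) atTop
      (𝓝 (∫ s in (0 : ℝ)..1, f s)) := by
  simp only [fun n : ℕ => sum_range_eq_intervalIntegral_floor f (Nat.succ_ne_zero n)]
  refine intervalIntegral.tendsto_integral_filter_of_dominated_convergence (fun _ => C) ?_ ?_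
    intervalIntegrable_const ?_
  · refine Eventually.of_forall fun n => ?_
    have h1 : StronglyMeasurable fun k : ℕ => f (k / ((n + 1 : ℕ) : ℝ)) :=
      StronglyMeasurable.of_discrete
    exact (h1.comp_measurable (Nat.measurable_floor.comp
      (measurable_const_mul ((n + 1 : ℕ) : ℝ)))).aestronglyMeasurable
  · exact Eventually.of_forall fun n => Eventually.of_forall fun s _ => hC _
  · filter_upwards [hf] with s hs hs2
    rw [uIoc_of_le zero_le_one] at hs2
    exact hs.tendsto.comp (tendsto_floor_mul_div s hs2.1.le)

/-! ### The Laplace exponent along a ray -/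

theorem IsContinuousLog.continuousOn_ray {φ ψ : ℂ → ℂ} (h : IsContinuousLog φ ψ) {u : ℂ}
    (hu : 0 ≤ u.re) : ContinuousOn (fun x : ℝ => ψ ((x : ℂ) * u)) (Ici 0) := by
  refine h.continuousOn.comp (by fun_prop) fun x hx => ?_
  simpa using mul_nonneg hx hu

theorem IsContinuousLog.exists_bound_ray {φ ψ : ℂ → ℂ} (h : IsContinuousLog φ ψ) {u : ℂ}
    (hu : 0 ≤ u.re) (M : ℝ) : ∃ C, ∀ x ∈ Icc (0 : ℝ) M, ‖ψ ((x : ℂ) * u)‖ ≤ C :=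
  isCompact_Icc.exists_bound_of_continuousOn
    ((h.continuousOn_ray hu).mono fun _ hx => hx.1)

/-! ### Weighted averages of a Lévy subordinator -/

namespace IsLevySubordinator

variable {Ω : Type u} [MeasurableSpace Ω] {P : Measure Ω} {X : ℝ≥0 → Ω → ℝ}
  [IsProbabilityMeasure P]

/-- The Laplace transform of a weighted sum of increments along a regular grid. -/
theorem laplaceTransform_sum_increments (hX : IsLevySubordinator P X) {ψ : ℂ → ℂ}
    (hψ : IsContinuousLog (laplaceTransform P (X 1)) ψ) (r : ℝ≥0) (K : ℕ) {w : ℕ → ℝ}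
    (hw : ∀ j, 0 ≤ w j) {u : ℂ} (hu : 0 ≤ u.re) :
    laplaceTransform P
      (fun ω => ∑ j ∈ Finset.range K, w j * (X ((j + 1 : ℕ) * r) ω - X (j * r) ω)) u =
      Complex.exp (∑ j ∈ Finset.range K, (r : ℝ) * ψ ((w j : ℂ) * u)) := by
  have hind := hX.indep_increments K (fun i => ((i : ℕ) : ℝ≥0) * r) (by
    intro i j hij
    have : ((i : ℕ) : ℝ≥0) ≤ ((j : ℕ) : ℝ≥0) := by exact_mod_cast hij
    exact mul_le_mul_left this r)
  have hm : ∀ j : ℕ, Measurable fun x : ℝ => Complex.exp (-u * (w j : ℂ) * (x : ℂ)) :=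
    fun j => by fun_prop
  have h := hind.integral_fun_prod_comp
    (f := fun (i : Fin K) (x : ℝ) => Complex.exp (-u * (w i : ℂ) * (x : ℂ)))
    (fun i => ((hX.measurable _).sub (hX.measurable _)).aemeasurable)
    (fun i => (hm i).aestronglyMeasurable)
  have hincr : ∀ j : ℕ, ∫ ω, Complex.exp (-u * (w j : ℂ) *
      ((X ((j + 1 : ℕ) * r) ω - X (j * r) ω : ℝ) : ℂ)) ∂P =
      Complex.exp ((r : ℝ) * ψ ((w j : ℂ) * u)) := by
    intro j
    rw [← hX.laplaceTransform_eq_exp hψ r (by simpa using mul_nonneg (hw j) hu),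
      ← laplaceTransform_identDistrib (hX.stationary_increments (j * r) r)]
    simp only [laplaceTransform]
    congr 1
    funext ω
    congr 1
    rw [show ((j + 1 : ℕ) : ℝ≥0) * r = j * r + r by push_cast; ring]
    simp only [Pi.sub_apply]
    ring
  rw [Complex.exp_sum, ← Finset.prod_congr rfl fun j _ => hincr j]
  rw [Finset.prod_range]
  simp only [Fin.val_succ, Fin.val_castSucc] at h
  rw [← h]
  simp only [laplaceTransform]
  congr 1
  funext ω
  rw [← Complex.exp_sum]
  congr 1
  push_cast
  rw [Finset.sum_range, Finset.mul_sum]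
  refine Finset.sum_congr rfl fun i _ => ?_
  ring

end IsLevySubordinator

/-- A weighted integral of a monotone right-continuous path is a limit of weighted sums of
increments. -/
theorem tendsto_sum_increments {f : ℝ≥0 → ℝ} (hmono : Monotone f)
    (hf : ∀ t, ContinuousWithinAt f (Ici t) t) (h0 : f 0 = 0) (μ : Measure ℝ) [IsFiniteMeasure μ]
    (hμ : ∀ᵐ s ∂μ, s ∈ Icc (0 : ℝ) 1) (t : ℝ≥0) :
    Tendsto (fun n : ℕ => ∑ j ∈ Finset.range (n + 1), μ.real (Ioi (j / ((n + 1 : ℕ) : ℝ))) *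
      (f ((j + 1 : ℕ) * (t / (n + 1 : ℕ))) - f (j * (t / (n + 1 : ℕ))))) atTop
      (𝓝 (∫ s, f ((t : ℝ) * s).toNNReal ∂μ)) := by
  -- Summation by parts in reverse: writing each tail mass as the integral of an indicator, the
  -- increments selected at `s` telescope to the value of `f` at the first grid point not below
  -- `ts`.
  set Φ : ℕ → ℝ → ℝ := fun n s => ∑ j ∈ Finset.range (n + 1),
    (Ioi (j / ((n + 1 : ℕ) : ℝ))).indicator (fun _ =>
      f ((j + 1 : ℕ) * (t / (n + 1 : ℕ))) - f (j * (t / (n + 1 : ℕ)))) s with hΦ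
  have hint : ∀ n, ∫ s, Φ n s ∂μ = ∑ j ∈ Finset.range (n + 1),
      μ.real (Ioi (j / ((n + 1 : ℕ) : ℝ))) *
      (f ((j + 1 : ℕ) * (t / (n + 1 : ℕ))) - f (j * (t / (n + 1 : ℕ)))) := by
    intro n
    rw [integral_finsetSum _ fun j _ => (integrable_const _).indicator measurableSet_Ioi]
    refine Finset.sum_congr rfl fun j _ => ?_
    rw [integral_indicator_const _ measurableSet_Ioi, smul_eq_mul]
  have hval : ∀ n, ∀ s ∈ Icc (0 : ℝ) 1,
      Φ n s = f (⌈((n + 1 : ℕ) : ℝ) * s⌉₊ * (t / (n + 1 : ℕ))) := by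
    intro n s hs
    have hpos : (0 : ℝ) < ((n + 1 : ℕ) : ℝ) := by positivity
    have hceil : ⌈((n + 1 : ℕ) : ℝ) * s⌉₊ ≤ n + 1 := by
      rw [Nat.ceil_le]
      nlinarith [hs.2]
    have hmem : ∀ j : ℕ, s ∈ Ioi (j / ((n + 1 : ℕ) : ℝ)) ↔ j ∈ Finset.range ⌈((n + 1 : ℕ) : ℝ) * s⌉₊ := by
      intro j
      rw [mem_Ioi, div_lt_iff₀ hpos, Finset.mem_range, Nat.lt_ceil, mul_comm]
    simp only [hΦ, indicator_apply, hmem]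
    rw [← Finset.sum_filter, Finset.filter_mem_eq_inter, Finset.inter_eq_right.2 (by simpa using hceil)]
    rw [Finset.sum_range_sub (fun j : ℕ => f (j * (t / (n + 1 : ℕ))))]
    simp [h0]
  simp only [← hint]
  refine tendsto_integral_of_dominated_convergence (fun _ => f t) ?_ (integrable_const _) ?_ ?_
  · intro n
    refine (Measurable.aestronglyMeasurable ?_)
    exact Finset.measurable_fun_sum _ fun j _ => measurable_const.indicator measurableSet_Ioi
  · intro n
    filter_upwards [hμ] with s hs
    have hpos : (0 : ℝ≥0) < ((n + 1 : ℕ) : ℝ≥0) := by positivity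
    have hceil : ⌈((n + 1 : ℕ) : ℝ) * s⌉₊ ≤ n + 1 := by
      rw [Nat.ceil_le]
      have : (0 : ℝ) < ((n + 1 : ℕ) : ℝ) := by positivity
      nlinarith [hs.2]
    rw [hval n s hs, Real.norm_eq_abs, abs_of_nonneg (by rw [← h0]; exact hmono (by simp))]
    refine hmono ?_
    calc (⌈((n + 1 : ℕ) : ℝ) * s⌉₊ : ℝ≥0) * (t / (n + 1 : ℕ))
        ≤ ((n + 1 : ℕ) : ℝ≥0) * (t / (n + 1 : ℕ)) := by gcongr
      _ = t := mul_div_cancel₀ _ hpos.ne'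
  · filter_upwards [hμ] with s hs
    have h1 : Tendsto (fun n : ℕ => (⌈((n + 1 : ℕ) : ℝ) * s⌉₊ : ℝ≥0) * (t / (n + 1 : ℕ)))
        atTop (𝓝 ((t : ℝ) * s).toNNReal) := by
      have h2 : ((((t : ℝ) * s).toNNReal : ℝ≥0) : ℝ) = t * s :=
        Real.coe_toNNReal _ (mul_nonneg t.2 hs.1)
      rw [← NNReal.tendsto_coe, h2]
      refine ((tendsto_ceil_mul_div s hs.1).const_mul (t : ℝ)).congr fun n => ?_
      push_cast
      ring
    -- Rounding up makes the grid points approach `ts` from the right, so right-continuity suffices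
    -- even at a jump.
    have h2 : Tendsto (fun n : ℕ => (⌈((n + 1 : ℕ) : ℝ) * s⌉₊ : ℝ≥0) * (t / (n + 1 : ℕ)))
        atTop (𝓝[≥] ((t : ℝ) * s).toNNReal) := by
      refine tendsto_nhdsWithin_iff.2 ⟨h1, Eventually.of_forall fun n => ?_⟩
      rw [mem_Ici, Real.toNNReal_le_iff_le_coe]
      push_cast
      rw [← mul_div_assoc, le_div_iff₀ (by positivity)]
      have := Nat.le_ceil (((n + 1 : ℕ) : ℝ) * s)
      push_cast at this
      calc (t : ℝ) * s * (n + 1) = (n + 1) * s * t := by ring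
        _ ≤ _ := by gcongr
    refine ((hf _).tendsto.comp h2).congr fun n => ?_
    rw [hval n s hs]
    rfl

namespace IsLevySubordinator

variable {Ω : Type u} [MeasurableSpace Ω] {P : Measure Ω} {X : ℝ≥0 → Ω → ℝ}
  [IsProbabilityMeasure P]

/-- The Laplace transform of a weighted average of the path of a Lévy subordinator. -/
theorem laplaceTransform_integral (hX : IsLevySubordinator P X) {ψ : ℂ → ℂ}
    (hψ : IsContinuousLog (laplaceTransform P (X 1)) ψ) (μ : Measure ℝ) [IsFiniteMeasure μ]
    (hμ : ∀ᵐ s ∂μ, s ∈ Icc (0 : ℝ) 1) (t : ℝ≥0) {u : ℂ} (hu : 0 ≤ u.re) :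
    laplaceTransform P (fun ω => ∫ s, X ((t : ℝ) * s).toNNReal ω ∂μ) u =
      Complex.exp ((t : ℝ) * ∫ s in (0 : ℝ)..1, ψ ((μ.real (Ioi s) : ℂ) * u)) := by
  set V : ℕ → Ω → ℝ := fun n ω => ∑ j ∈ Finset.range (n + 1),
    μ.real (Ioi (j / ((n + 1 : ℕ) : ℝ))) *
      (X ((j + 1 : ℕ) * (t / (n + 1 : ℕ))) ω - X (j * (t / (n + 1 : ℕ))) ω) with hV
  have h1 : Tendsto (fun n => laplaceTransform P (V n) u) atTop
      (𝓝 (laplaceTransform P (fun ω => ∫ s, X ((t : ℝ) * s).toNNReal ω ∂μ) u)) := by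
    refine tendsto_laplaceTransform (fun n => ?_) (Eventually.of_forall fun n => ?_) ?_ hu
    · exact (Finset.measurable_fun_sum _ fun j _ =>
        ((hX.measurable _).sub (hX.measurable _)).const_mul _).aemeasurable
    · filter_upwards [hX.ae_monotone] with ω hω
      refine Finset.sum_nonneg fun j _ => mul_nonneg measureReal_nonneg (sub_nonneg.2 (hω ?_))
      gcongr
      exact Nat.le_succ j
    · filter_upwards [hX.ae_monotone, hX.ae_rightContinuous, hX.start_zero] with ω h1 h2 h3
      exact tendsto_sum_increments h1 h2 h3 μ hμ t
  have hmem : ∀ s, μ.real (Ioi s) ∈ Icc 0 (μ.real univ) := fun s =>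
    ⟨measureReal_nonneg, measureReal_mono (subset_univ _)⟩
  obtain ⟨C, hC⟩ := hψ.exists_bound_ray hu (μ.real univ)
  have hanti : Antitone fun s => μ.real (Ioi s) := fun a b hab =>
    measureReal_mono (Ioi_subset_Ioi hab)
  have h2 : Tendsto (fun n => laplaceTransform P (V n) u) atTop
      (𝓝 (Complex.exp ((t : ℝ) * ∫ s in (0 : ℝ)..1, ψ ((μ.real (Ioi s) : ℂ) * u)))) := by
    have h3 := tendsto_riemannSum (f := fun s => ψ ((μ.real (Ioi s) : ℂ) * u))
      (fun s => hC _ (hmem s)) (by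
        have h4 : ∀ᵐ s ∂volume, ContinuousAt (fun s => μ.real (Ioi s)) s :=
          hanti.countable_not_continuousAt.ae_notMem _ |>.mono fun s hs => by simpa using hs
        filter_upwards [h4] with s hs
        have h5 := hψ.continuousOn_ray hu (μ.real (Ioi s)) (hmem s).1
        exact h5.tendsto.comp (tendsto_nhdsWithin_iff.2
          ⟨hs, Eventually.of_forall fun r => (hmem r).1⟩))
    refine ((Complex.continuous_exp.tendsto _).comp (h3.const_mul ((t : ℝ) : ℂ))).congr fun n => ?_
    rw [hV, hX.laplaceTransform_sum_increments hψ (t / (n + 1 : ℕ)) (n + 1)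
      (w := fun j => μ.real (Ioi (j / ((n + 1 : ℕ) : ℝ)))) (fun j => measureReal_nonneg) hu]
    simp only [Function.comp_apply, Finset.mul_sum]
    congr 1
    refine Finset.sum_congr rfl fun j _ => ?_
    rw [Complex.real_smul]
    push_cast
    ring
  exact tendsto_nhds_unique h1 h2

end IsLevySubordinator

/-! ### The incomplete gamma kernel -/

theorem intervalIntegrable_rpow_mul_exp_neg {n : ℝ} (hn : 0 < n) (a b : ℝ) :
    IntervalIntegrable (fun y : ℝ => y ^ (n - 1) * Real.exp (-y)) volume a b :=
  (intervalIntegral.intervalIntegrable_rpow' (by linarith)).mul_continuousOn (by fun_prop)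

theorem integrableOn_rpow_mul_exp_neg {n : ℝ} (hn : 0 < n) :
    IntegrableOn (fun y : ℝ => y ^ (n - 1) * Real.exp (-y)) (Ioi 0) :=
  (Real.GammaIntegral_convergent hn).congr_fun (fun _ _ => mul_comm _ _) measurableSet_Ioi

theorem integral_rpow_mul_exp_neg {n : ℝ} (hn : 0 < n) :
    ∫ y in Ioi (0 : ℝ), y ^ (n - 1) * Real.exp (-y) = Real.Gamma n := by
  rw [Real.Gamma_eq_integral hn]
  exact setIntegral_congr_fun measurableSet_Ioi fun y _ => mul_comm _ _

theorem upperGamma_eq {n : ℝ} (hn : 0 < n) {x : ℝ} (hx : 0 ≤ x) :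
    upperGamma n x = Real.Gamma n - ∫ y in (0 : ℝ)..x, y ^ (n - 1) * Real.exp (-y) := by
  rw [← intervalIntegral.integral_Ioi_sub_Ioi (integrableOn_rpow_mul_exp_neg hn) hx,
    integral_rpow_mul_exp_neg hn, upperGamma]
  ring

theorem gammaKernel_eq {n : ℝ} (hn : 0 < n) {s : ℝ} (hs0 : 0 ≤ s) (hs : s ≤ 1) :
    gammaKernel n s =
      (∫ y in (0 : ℝ)..(-Real.log s), y ^ (n - 1) * Real.exp (-y)) / Real.Gamma n := by
  rw [gammaKernel, upperGamma_eq hn (neg_nonneg.2 (Real.log_nonpos hs0 hs)), sub_div,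
    div_self (Real.Gamma_pos_of_pos hn).ne']
  ring

theorem gammaKernel_nonneg {n : ℝ} (hn : 0 < n) {s : ℝ} (hs0 : 0 ≤ s) (hs : s ≤ 1) :
    0 ≤ gammaKernel n s := by
  rw [gammaKernel_eq hn hs0 hs]
  refine div_nonneg (intervalIntegral.integral_nonneg (neg_nonneg.2 (Real.log_nonpos hs0 hs))
    fun y hy => ?_) (Real.Gamma_pos_of_pos hn).le
  exact mul_nonneg (Real.rpow_nonneg hy.1 _) (Real.exp_nonneg _)

theorem gammaKernel_le_one {n : ℝ} (hn : 0 < n) {s : ℝ} (hs0 : 0 ≤ s) (hs : s ≤ 1) :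
    gammaKernel n s ≤ 1 := by
  have h : 0 ≤ upperGamma n (-Real.log s) := by
    refine setIntegral_nonneg measurableSet_Ioi fun y hy => ?_
    have hy' : 0 ≤ y := (neg_nonneg.2 (Real.log_nonpos hs0 hs)).trans (le_of_lt hy)
    exact mul_nonneg (Real.rpow_nonneg hy' _) (Real.exp_nonneg _)
  have := div_nonneg h (Real.Gamma_pos_of_pos hn).le
  rw [gammaKernel]
  linarith

/-- The density `(-log v)ⁿ⁻¹ / Γ(n)` of `exp (-G)` for a gamma variable `G` of shape `n`. -/
noncomputable def logGammaDensity (n v : ℝ) : ℝ :=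
  (-Real.log v) ^ (n - 1) / Real.Gamma n

theorem measurable_logGammaDensity (n : ℝ) : Measurable (logGammaDensity n) := by
  unfold logGammaDensity
  fun_prop

theorem logGammaDensity_nonneg {n : ℝ} (hn : 0 < n) {v : ℝ} (hv : v ∈ Ioo (0 : ℝ) 1) :
    0 ≤ logGammaDensity n v :=
  div_nonneg (Real.rpow_nonneg (neg_nonneg.2 (Real.log_nonpos hv.1.le hv.2.le)) _)
    (Real.Gamma_pos_of_pos hn).le

theorem logGammaDensity_pos {n : ℝ} (hn : 0 < n) {v : ℝ} (hv : v ∈ Ioo (0 : ℝ) 1) :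
    0 < logGammaDensity n v :=
  div_pos (Real.rpow_pos_of_pos (neg_pos.2 (Real.log_neg hv.1 hv.2)) _)
    (Real.Gamma_pos_of_pos hn)

theorem hasDerivAt_gammaKernel {n : ℝ} (hn : 0 < n) {s : ℝ} (hs : s ∈ Ioo (0 : ℝ) 1) :
    HasDerivAt (gammaKernel n) (-logGammaDensity n s) s := by
  have hx : 0 < -Real.log s := neg_pos.2 (Real.log_neg hs.1 hs.2)
  have hm : Measurable fun y : ℝ => y ^ (n - 1) * Real.exp (-y) := by fun_prop
  have h1 : HasDerivAt (fun x => ∫ y in (0 : ℝ)..x, y ^ (n - 1) * Real.exp (-y))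
      ((-Real.log s) ^ (n - 1) * Real.exp (-(-Real.log s))) (-Real.log s) := by
    refine intervalIntegral.integral_hasDerivAt_right
      (intervalIntegrable_rpow_mul_exp_neg hn _ _)
      hm.stronglyMeasurable.stronglyMeasurableAtFilter ?_
    exact (Real.continuousAt_rpow_const _ _ (Or.inl hx.ne')).mul (by fun_prop)
  have h2 : HasDerivAt (fun s => -Real.log s) (-s⁻¹) s := (Real.hasDerivAt_log hs.1.ne').neg
  have h3 := (h1.comp s h2).div_const (Real.Gamma n)
  have h4 : (fun s => (∫ y in (0 : ℝ)..(-Real.log s), y ^ (n - 1) * Real.exp (-y)) /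
      Real.Gamma n) =ᶠ[𝓝 s] gammaKernel n := by
    filter_upwards [Ioo_mem_nhds hs.1 hs.2] with x hx
    exact (gammaKernel_eq hn hx.1.le hx.2.le).symm
  refine (h4.hasDerivAt_iff.1 h3).congr_deriv ?_
  rw [neg_neg, Real.exp_log hs.1, logGammaDensity]
  have := hs.1.ne'
  field_simp

theorem strictAntiOn_gammaKernel {n : ℝ} (hn : 0 < n) :
    StrictAntiOn (gammaKernel n) (Ioo 0 1) := by
  refine strictAntiOn_of_deriv_neg (convex_Ioo 0 1)
    (fun s hs => (hasDerivAt_gammaKernel hn hs).continuousAt.continuousWithinAt) fun s hs => ?_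
  rw [interior_Ioo] at hs
  rw [(hasDerivAt_gammaKernel hn hs).deriv]
  exact neg_neg_of_pos (logGammaDensity_pos hn hs)

theorem gammaKernel_mem_Ioo {n : ℝ} (hn : 0 < n) {s : ℝ} (hs : s ∈ Ioo (0 : ℝ) 1) :
    gammaKernel n s ∈ Ioo (0 : ℝ) 1 := by
  have h1 : s / 2 ∈ Ioo (0 : ℝ) 1 := ⟨by linarith [hs.1], by linarith [hs.1, hs.2]⟩
  have h2 : (1 + s) / 2 ∈ Ioo (0 : ℝ) 1 := ⟨by linarith [hs.1], by linarith [hs.2]⟩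
  exact ⟨(gammaKernel_nonneg hn h2.1.le h2.2.le).trans_lt
      (strictAntiOn_gammaKernel hn hs h2 (by linarith [hs.2])),
    (strictAntiOn_gammaKernel hn h1 hs (by linarith [hs.1])).trans_le
      (gammaKernel_le_one hn h1.1.le h1.2.le)⟩

/-- Only the limit equals `1`: since `Real.log 0 = 0`, the kernel takes the value `0` at `0`. This
is why the kernel is studied on the open interval. -/
theorem tendsto_gammaKernel_zero {n : ℝ} (hn : 0 < n) :
    Tendsto (gammaKernel n) (𝓝[>] 0) (𝓝 1) := by
  have h1 : Tendsto (fun s => -Real.log s) (𝓝[>] 0) atTop :=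
    tendsto_neg_atBot_atTop.comp Real.tendsto_log_nhdsGT_zero
  have h2 := (intervalIntegral_tendsto_integral_Ioi 0 (integrableOn_rpow_mul_exp_neg hn) h1).div_const
    (Real.Gamma n)
  rw [integral_rpow_mul_exp_neg hn, div_self (Real.Gamma_pos_of_pos hn).ne'] at h2
  refine h2.congr' ?_
  filter_upwards [Ioo_mem_nhdsGT (zero_lt_one (α := ℝ))] with s hs
  exact (gammaKernel_eq hn hs.1.le hs.2.le).symm

theorem tendsto_gammaKernel_one {n : ℝ} (hn : 0 < n) :
    Tendsto (gammaKernel n) (𝓝[<] 1) (𝓝 0) := by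
  have hc := intervalIntegral.continuous_primitive (intervalIntegrable_rpow_mul_exp_neg hn) 0
  have h1 : Tendsto (fun s => -Real.log s) (𝓝[<] 1) (𝓝 0) := by
    have : ContinuousAt (fun s => -Real.log s) 1 := (Real.continuousAt_log one_ne_zero).neg
    have h := this.tendsto
    rw [Real.log_one, neg_zero] at h
    exact h.mono_left nhdsWithin_le_nhds
  have h2 := ((hc.tendsto 0).comp h1).div_const (Real.Gamma n)
  rw [intervalIntegral.integral_same, zero_div] at h2
  refine h2.congr' ?_
  filter_upwards [Ioo_mem_nhdsLT (zero_lt_one (α := ℝ))] with s hs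
  exact (gammaKernel_eq hn hs.1.le hs.2.le).symm

theorem image_gammaKernel {n : ℝ} (hn : 0 < n) : gammaKernel n '' Ioo 0 1 = Ioo 0 1 := by
  refine subset_antisymm (image_subset_iff.2 fun s hs => gammaKernel_mem_Ioo hn hs) ?_
  have : NeBot (𝓝[>] (0 : ℝ)) := inferInstance
  refine isPreconnected_Ioo.intermediate_value_Ioo (l₁ := 𝓝[<] 1) (l₂ := 𝓝[>] 0) ?_ ?_
    (fun s hs => (hasDerivAt_gammaKernel hn hs).continuousAt.continuousWithinAt)
    (tendsto_gammaKernel_one hn) (tendsto_gammaKernel_zero hn)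
  · exact le_principal_iff.2 (Ioo_mem_nhdsLT zero_lt_one)
  · exact le_principal_iff.2 (Ioo_mem_nhdsGT zero_lt_one)

/-- Change of variables along the gamma kernel. -/
theorem lintegral_comp_gammaKernel {n : ℝ} (hn : 0 < n) (g : ℝ → ENNReal) :
    ∫⁻ s in Ioo (0 : ℝ) 1, g s =
      ∫⁻ v in Ioo (0 : ℝ) 1, ENNReal.ofReal (logGammaDensity n v) * g (gammaKernel n v) := by
  have h := lintegral_image_eq_lintegral_abs_deriv_mul measurableSet_Ioo
    (fun s hs => (hasDerivAt_gammaKernel hn hs).hasDerivWithinAt)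
    (strictAntiOn_gammaKernel hn).injOn g
  rw [image_gammaKernel hn] at h
  rw [h]
  refine setLIntegral_congr_fun measurableSet_Ioo fun v hv => ?_
  simp only [abs_neg, abs_of_nonneg (logGammaDensity_nonneg hn hv)]

theorem integral_comp_gammaKernel {E : Type*} [NormedAddCommGroup E] [NormedSpace ℝ E]
    {n : ℝ} (hn : 0 < n) (g : ℝ → E) :
    ∫ s in (0 : ℝ)..1, g s =
      ∫ v in (0 : ℝ)..1, logGammaDensity n v • g (gammaKernel n v) := by
  have h := integral_image_eq_integral_abs_deriv_smul measurableSet_Ioo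
    (fun s hs => (hasDerivAt_gammaKernel hn hs).hasDerivWithinAt)
    (strictAntiOn_gammaKernel hn).injOn g
  rw [image_gammaKernel hn] at h
  rw [intervalIntegral.integral_of_le zero_le_one, intervalIntegral.integral_of_le zero_le_one,
    integral_Ioc_eq_integral_Ioo, integral_Ioc_eq_integral_Ioo, h]
  refine setIntegral_congr_fun measurableSet_Ioo fun v hv => ?_
  simp only [abs_neg, abs_of_nonneg (logGammaDensity_nonneg hn hv)]

/-! ### Measures on the unit interval given by a density -/

/-- The measure on `(0, 1)` with density `f`. -/
noncomputable def unitDensity (f : ℝ → ℝ) : Measure ℝ :=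
  (volume.restrict (Ioo 0 1)).withDensity fun v => ENNReal.ofReal (f v)

theorem ae_unitDensity_mem_Ioo (f : ℝ → ℝ) : ∀ᵐ v ∂unitDensity f, v ∈ Ioo (0 : ℝ) 1 :=
  (withDensity_absolutelyContinuous _ _).ae_le (ae_restrict_mem measurableSet_Ioo)

theorem ae_unitDensity_mem_Icc (f : ℝ → ℝ) : ∀ᵐ v ∂unitDensity f, v ∈ Icc (0 : ℝ) 1 :=
  (ae_unitDensity_mem_Ioo f).mono fun _ hv => Ioo_subset_Icc_self hv

theorem integral_unitDensity {E : Type*} [NormedAddCommGroup E] [NormedSpace ℝ E]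
    {f : ℝ → ℝ} (hf : Measurable f) (hpos : ∀ v ∈ Ioo (0 : ℝ) 1, 0 ≤ f v) (g : ℝ → E) :
    ∫ v, g v ∂unitDensity f = ∫ v in (0 : ℝ)..1, f v • g v := by
  rw [unitDensity, integral_withDensity_eq_integral_toReal_smul (by fun_prop)
    (Eventually.of_forall fun _ => ENNReal.ofReal_lt_top),
    intervalIntegral.integral_of_le zero_le_one, integral_Ioc_eq_integral_Ioo]
  refine setIntegral_congr_fun measurableSet_Ioo fun v hv => ?_
  simp only [ENNReal.toReal_ofReal (hpos v hv)]

theorem lintegral_unitDensity {f : ℝ → ℝ} (hf : Measurable f) {g : ℝ → ENNReal}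
    (hg : Measurable g) : ∫⁻ v, g v ∂unitDensity f =
      ∫⁻ v in Ioo (0 : ℝ) 1, ENNReal.ofReal (f v) * g v := by
  rw [unitDensity, lintegral_withDensity_eq_lintegral_mul _ (by fun_prop) hg]
  rfl

/-- The density is `|k'|` for the bijection `k = gammaKernel n` of `(0,1)`, so its total mass is the
length of the interval. -/
theorem isProbabilityMeasure_logGamma {n : ℝ} (hn : 0 < n) :
    IsProbabilityMeasure (unitDensity (logGammaDensity n)) := by
  constructor
  have h := lintegral_comp_gammaKernel hn 1
  rw [← lintegral_one, lintegral_unitDensity (measurable_logGammaDensity n) measurable_const]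
  simp only [Pi.one_apply] at h
  rw [← h]
  simp

/-- The decreasing kernel carries `(s,1)` onto `(0, k(s))`, whose length is the mass sought. -/
theorem logGamma_Ioi {n : ℝ} (hn : 0 < n) {s : ℝ} (hs : s ∈ Ioo (0 : ℝ) 1) :
    (unitDensity (logGammaDensity n)).real (Ioi s) = gammaKernel n s := by
  have hk := gammaKernel_mem_Ioo hn hs
  have h1 : unitDensity (logGammaDensity n) (Ioi s) = volume (Iio (gammaKernel n s) ∩ Ioo 0 1) := by
    have h2 := lintegral_comp_gammaKernel hn ((Iio (gammaKernel n s)).indicator 1)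
    rw [lintegral_indicator_one measurableSet_Iio, Measure.restrict_apply measurableSet_Iio] at h2
    rw [h2, ← lintegral_indicator_one measurableSet_Ioi,
      lintegral_unitDensity (measurable_logGammaDensity n)
        (measurable_one.indicator measurableSet_Ioi)]
    refine setLIntegral_congr_fun measurableSet_Ioo fun v hv => ?_
    have h3 : v ∈ Ioi s ↔ gammaKernel n v ∈ Iio (gammaKernel n s) :=
      ((strictAntiOn_gammaKernel hn).lt_iff_gt hv hs).symm
    by_cases h4 : v ∈ Ioi s
    · simp [indicator_of_mem h4, indicator_of_mem (h3.1 h4)]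
    · simp [indicator_of_notMem h4, indicator_of_notMem (mt h3.2 h4)]
  have h5 : Iio (gammaKernel n s) ∩ Ioo 0 1 = Ioo 0 (gammaKernel n s) := by
    ext x
    simp only [mem_inter_iff, mem_Iio, mem_Ioo]
    exact ⟨fun h => ⟨h.2.1, h.1⟩, fun h => ⟨h.2, h.1, h.2.trans hk.2⟩⟩
  rw [measureReal_def, h1, h5, Real.volume_Ioo, sub_zero, ENNReal.toReal_ofReal hk.1.le]

theorem logGammaDensity_one (v : ℝ) : logGammaDensity 1 v = 1 := by
  simp [logGammaDensity]

theorem integrable_unitDensity_iff_intervalIntegrable {E : Type*} [NormedAddCommGroup E]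
    [NormedSpace ℝ E] {f : ℝ → ℝ} (hf : Measurable f) (hpos : ∀ v ∈ Ioo (0 : ℝ) 1, 0 ≤ f v)
    (g : ℝ → E) : Integrable g (unitDensity f) ↔
      IntervalIntegrable (fun v => f v • g v) volume 0 1 := by
  rw [unitDensity, integrable_withDensity_iff_integrable_smul' (by fun_prop)
    (Eventually.of_forall fun _ => ENNReal.ofReal_lt_top),
    intervalIntegrable_iff_integrableOn_Ioo_of_le zero_le_one]
  refine integrable_congr ?_
  filter_upwards [ae_restrict_mem measurableSet_Ioo] with v hv
  rw [ENNReal.toReal_ofReal (hpos v hv)]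

/-- The product of independent variables with laws `logGamma n` and uniform has law
`logGamma (n + 1)`. -/
theorem map_mul_logGamma_prod {n : ℝ} (hn : 0 < n) :
    ((unitDensity (logGammaDensity n)).prod (volume.restrict (Ioo (0 : ℝ) 1))).map
      (fun p => p.1 * p.2) = unitDensity (logGammaDensity (n + 1)) := by
  have := isProbabilityMeasure_logGamma hn
  have hd := measurable_logGammaDensity n
  refine Measure.ext_of_lintegral _ fun f hf => ?_
  rw [lintegral_map hf (by fun_prop), lintegral_prod _ (by fun_prop),
    lintegral_unitDensity hd (Measurable.lintegral_prod_right' (f := fun p : ℝ × ℝ => f (p.1 * p.2)) (by fun_prop)),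
    lintegral_unitDensity (measurable_logGammaDensity _) hf]
  -- For fixed `v`, the product of `v` and a uniform variable has density `1/v` on `(0,v)`.
  have h1 : ∀ v ∈ Ioo (0 : ℝ) 1, ENNReal.ofReal (logGammaDensity n v) *
      ∫⁻ s in Ioo (0 : ℝ) 1, f (v * s) = ∫⁻ w in Ioo (0 : ℝ) 1,
        (Ioi w).indicator (fun v => ENNReal.ofReal (logGammaDensity n v / v)) v * f w := by
    intro v hv
    have himg : (fun s => v * s) '' Ioo (0 : ℝ) 1 = Ioo 0 v := by
      rw [image_mul_left_Ioo hv.1, mul_zero, mul_one]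
    have h2 := lintegral_image_eq_lintegral_abs_deriv_mul (s := Ioo (0 : ℝ) 1) measurableSet_Ioo
      (f := fun s => v * s) (f' := fun _ => v)
      (fun s _ => by simpa using ((hasDerivAt_id s).const_mul v).hasDerivWithinAt)
      (fun a _ b _ h => mul_left_cancel₀ hv.1.ne' h) f
    rw [himg, abs_of_pos hv.1, lintegral_const_mul _ (by fun_prop)] at h2
    have h3 : ∀ w, (Ioi w).indicator (fun v => ENNReal.ofReal (logGammaDensity n v / v)) v * f w =
        ENNReal.ofReal (logGammaDensity n v / v) * (Iio v).indicator f w := by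
      intro w
      by_cases hw : w < v
      · rw [indicator_of_mem (mem_Ioi.2 hw), indicator_of_mem (mem_Iio.2 hw)]
      · rw [indicator_of_notMem (by simpa using hw), indicator_of_notMem (by simpa using hw)]
        simp
    simp only [h3]
    rw [lintegral_const_mul _ (hf.indicator measurableSet_Iio),
      setLIntegral_indicator measurableSet_Iio]
    have h5 : Iio v ∩ Ioo 0 1 = Ioo 0 v := by
      ext x
      simp only [mem_inter_iff, mem_Iio, mem_Ioo]
      exact ⟨fun h => ⟨h.2.1, h.1⟩, fun h => ⟨h.2, h.1, h.2.trans hv.2⟩⟩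
    rw [h5, h2, ← mul_assoc, ← ENNReal.ofReal_mul (div_nonneg (logGammaDensity_nonneg hn hv) hv.1.le),
      div_mul_cancel₀ _ hv.1.ne']
  -- After Tonelli, the density at `w` is the integral over `(w,1)` of the degree-`n` density
  -- divided by `v`; it must equal the density of degree `n+1`.
  rw [setLIntegral_congr_fun measurableSet_Ioo h1, lintegral_lintegral_swap ?_]
  · refine setLIntegral_congr_fun measurableSet_Ioo fun w hw => ?_
    rw [lintegral_mul_const _ ((by fun_prop : Measurable fun v =>
      ENNReal.ofReal (logGammaDensity n v / v)).indicator measurableSet_Ioi),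
      setLIntegral_indicator measurableSet_Ioi]
    congr 1
    have h5 : Ioi w ∩ Ioo 0 1 = Ioo w 1 := by
      ext x
      simp only [mem_inter_iff, mem_Ioi, mem_Ioo]
      exact ⟨fun h => ⟨h.1, h.2.2⟩, fun h => ⟨h.1, hw.1.trans h.1, h.2⟩⟩
    rw [h5]
    have hsub : ∀ v ∈ Ioo w 1, v ∈ Ioo (0 : ℝ) 1 := fun v hv => ⟨hw.1.trans hv.1, hv.2⟩
    have hder : ∀ v ∈ Ioo (0 : ℝ) 1, HasDerivAt (logGammaDensity (n + 1))
        (-(logGammaDensity n v / v)) v := by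
      intro v hv
      have hlog : 0 < -Real.log v := neg_pos.2 (Real.log_neg hv.1 hv.2)
      have := (((Real.hasDerivAt_log hv.1.ne').neg).rpow_const (p := n + 1 - 1)
        (Or.inl hlog.ne')).div_const (Real.Gamma (n + 1))
      refine HasDerivAt.congr_deriv this ?_
      rw [logGammaDensity, Real.Gamma_add_one hn.ne', add_sub_cancel_right]
      have := hv.1.ne'
      have := (Real.Gamma_pos_of_pos hn).ne'
      have := hn.ne'
      field_simp
      rfl
    have hanti : StrictAntiOn (logGammaDensity (n + 1)) (Ioc 0 1) := by
      refine strictAntiOn_of_deriv_neg (convex_Ioc 0 1) ?_ fun v hv => ?_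
      · unfold logGammaDensity
        refine ContinuousOn.div_const (ContinuousOn.rpow_const
          (ContinuousOn.neg (Real.continuousOn_log.mono fun x hx => hx.1.ne')) fun x _ => Or.inr ?_) _
        linarith
      · rw [interior_Ioc] at hv
        rw [(hder v hv).deriv]
        exact neg_neg_of_pos (div_pos (logGammaDensity_pos hn hv) hv.1)
    have h1 : logGammaDensity (n + 1) 1 = 0 := by
      simp [logGammaDensity, Real.zero_rpow hn.ne']
    have himg : logGammaDensity (n + 1) '' Ioo w 1 = Ioo 0 (logGammaDensity (n + 1) w) := by
      have hsub : Icc w 1 ⊆ Ioc 0 1 := fun x hx => ⟨hw.1.trans_le hx.1, hx.2⟩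
      rw [ContinuousOn.image_Ioo_of_strictAntiOn hw.2.le ?_ (hanti.mono hsub), h1]
      unfold logGammaDensity
      refine ContinuousOn.div_const (ContinuousOn.rpow_const
        (ContinuousOn.neg (Real.continuousOn_log.mono fun x hx => (hsub hx).1.ne')) fun x _ => Or.inr ?_) _
      linarith
    -- The integrand is minus the derivative of the density of degree `n+1`, so its integral is the
    -- length of an image interval. No integrability check is needed, although the integrand is
    -- unbounded near `1` when `n < 1`.
    have h2 := lintegral_image_eq_lintegral_abs_deriv_mul (s := Ioo w 1) measurableSet_Ioo
      (fun v hv => (hder v (hsub v hv)).hasDerivWithinAt)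
      (hanti.injOn.mono (show Ioo w 1 ⊆ Ioc 0 1 from fun v hv => ⟨(hsub v hv).1, hv.2.le⟩)) 1
    rw [himg] at h2
    simp only [Pi.one_apply, mul_one, lintegral_one, Measure.restrict_apply_univ, Real.volume_Ioo,
      sub_zero] at h2
    rw [h2]
    refine setLIntegral_congr_fun measurableSet_Ioo fun v hv => ?_
    simp only [abs_neg]
    rw [abs_of_nonneg (div_nonneg (logGammaDensity_nonneg hn (hsub v hv)) (hsub v hv).1.le)]
  · refine Measurable.aemeasurable ?_
    simp only [Function.uncurry_def]
    refine Measurable.mul ?_ (by fun_prop)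
    have : (fun p : ℝ × ℝ => (Ioi p.2).indicator (fun v => ENNReal.ofReal (logGammaDensity n v / v)) p.1) =
        {p : ℝ × ℝ | p.2 < p.1}.indicator fun p => ENNReal.ofReal (logGammaDensity n p.1 / p.1) := by
      funext p
      simp only [indicator_apply, mem_Ioi, mem_ofPred_eq]
    rw [this]
    exact Measurable.indicator (by fun_prop) (measurableSet_lt measurable_snd measurable_fst)

theorem integral_integral_mul_logGamma {E : Type*} [NormedAddCommGroup E] [NormedSpace ℝ E]
    {n : ℝ} (hn : 0 < n) {g : ℝ → E}
    (hg : Integrable g (unitDensity (logGammaDensity (n + 1)))) :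
    ∫ s in (0 : ℝ)..1, ∫ v, g (s * v) ∂unitDensity (logGammaDensity n) =
      ∫ v, g v ∂unitDensity (logGammaDensity (n + 1)) := by
  have := isProbabilityMeasure_logGamma hn
  rw [← map_mul_logGamma_prod hn] at hg ⊢
  have hm : AEMeasurable (fun p : ℝ × ℝ => p.1 * p.2)
    ((unitDensity (logGammaDensity n)).prod (volume.restrict (Ioo (0 : ℝ) 1))) := by fun_prop
  rw [integral_map hm hg.aestronglyMeasurable, integral_prod_symm]
  · rw [intervalIntegral.integral_of_le zero_le_one, integral_Ioc_eq_integral_Ioo]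
    simp only [mul_comm]
  · exact hg.comp_aemeasurable hm

theorem intervalIntegral_congr_Ioo {E : Type*} [NormedAddCommGroup E] [NormedSpace ℝ E]
    {f g : ℝ → E} {a b : ℝ} (hab : a ≤ b) (h : ∀ s ∈ Ioo a b, f s = g s) :
    ∫ s in a..b, f s = ∫ s in a..b, g s := by
  rw [intervalIntegral.integral_of_le hab, intervalIntegral.integral_of_le hab,
    integral_Ioc_eq_integral_Ioo, integral_Ioc_eq_integral_Ioo]
  exact setIntegral_congr_fun measurableSet_Ioo h

/-! ### Convergence of the exponents -/

section Exponents

variable {φ ψ : ℂ → ℂ}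

theorem intervalIntegrable_integrandI (hψ : IsContinuousLog φ ψ) {n : ℝ} (hn : 0 < n) {u : ℂ}
    (hu : 0 ≤ u.re) : IntervalIntegrable (integrandI ψ n u) volume 0 1 := by
  obtain ⟨C, hC⟩ := hψ.exists_bound_ray hu 1
  rw [intervalIntegrable_iff_integrableOn_Ioo_of_le zero_le_one]
  refine Integrable.mono' (integrable_const C)
    (ContinuousOn.aestronglyMeasurable ?_ measurableSet_Ioo) ?_
  · exact (hψ.continuousOn_ray hu).comp
      (fun s hs => (hasDerivAt_gammaKernel hn hs).continuousAt.continuousWithinAt)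
      fun s hs => (gammaKernel_mem_Ioo hn hs).1.le
  · filter_upwards [ae_restrict_mem measurableSet_Ioo] with s hs
    exact hC _ (Ioo_subset_Icc_self (gammaKernel_mem_Ioo hn hs))

theorem integrable_ray_unitDensity (hψ : IsContinuousLog φ ψ) {u : ℂ} (hu : 0 ≤ u.re)
    (f : ℝ → ℝ) [IsFiniteMeasure (unitDensity f)] :
    Integrable (fun v : ℝ => ψ ((v : ℂ) * u)) (unitDensity f) := by
  obtain ⟨C, hC⟩ := hψ.exists_bound_ray hu 1
  refine Integrable.mono' (integrable_const C) ?_ ?_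
  · have h : AEStronglyMeasurable (fun v : ℝ => ψ ((v : ℂ) * u)) (volume.restrict (Ioo 0 1)) :=
      ((hψ.continuousOn_ray hu).mono fun v hv => hv.1.le).aestronglyMeasurable measurableSet_Ioo
    exact h.mono_ac (withDensity_absolutelyContinuous _ _)
  · filter_upwards [ae_unitDensity_mem_Icc f] with v hv using hC v hv

theorem integrandII_eq {n : ℝ} (hn : 0 < n) (u : ℂ) (v : ℝ) :
    integrandII ψ n u v = Real.Gamma n • (logGammaDensity n v • ψ ((v : ℂ) * u)) := by
  rw [integrandII, smul_smul, logGammaDensity, mul_div_cancel₀ _ (Real.Gamma_pos_of_pos hn).ne',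
    Complex.real_smul, mul_comm u]

theorem intervalIntegrable_integrandII (hψ : IsContinuousLog φ ψ) {n : ℝ} (hn : 0 < n) {u : ℂ}
    (hu : 0 ≤ u.re) : IntervalIntegrable (integrandII ψ n u) volume 0 1 := by
  have := isProbabilityMeasure_logGamma hn
  have h := (integrable_unitDensity_iff_intervalIntegrable (measurable_logGammaDensity n)
    (fun v hv => logGammaDensity_nonneg hn hv) _).1
    (integrable_ray_unitDensity hψ hu (logGammaDensity n))
  rw [funext (integrandII_eq hn u)]
  exact h.smul (Real.Gamma n)

theorem intervalIntegrable_integrandIII (hψ : IsContinuousLog φ ψ) {n : ℝ} (hn : 0 < n) {u : ℂ}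
    (hu : 0 ≤ u.re) : IntervalIntegrable (integrandIII ψ n u) volume 0 1 := by
  refine ContinuousOn.intervalIntegrable ?_
  rw [uIcc_of_le zero_le_one]
  have h : integrandIII ψ n u = fun s : ℝ => ψ (((s ^ n / Real.Gamma (n + 1) : ℝ) : ℂ) * u) := by
    funext s
    rw [integrandIII]
    push_cast
    congr 1
    ring
  rw [h]
  refine (hψ.continuousOn_ray hu).comp (f := fun s : ℝ => s ^ n / Real.Gamma (n + 1)) ?_ fun s hs =>
    div_nonneg (Real.rpow_nonneg hs.1 _) (Real.Gamma_pos_of_pos (by linarith)).le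
  exact ContinuousOn.div_const (continuousOn_id.rpow_const fun _ _ => Or.inr hn.le) _

theorem formulaII_eq {n : ℝ} (hn : 0 < n) (t : ℝ≥0) (u : ℂ) :
    formulaII ψ n t u = Complex.exp
      ((t : ℝ) * ∫ v, ψ ((v : ℂ) * u) ∂unitDensity (logGammaDensity n)) := by
  rw [formulaII, integral_unitDensity (measurable_logGammaDensity n)
    (fun v hv => logGammaDensity_nonneg hn hv), funext (integrandII_eq hn u),
    intervalIntegral.integral_smul, Complex.real_smul, ← mul_assoc, ← Complex.ofReal_mul,
    div_mul_cancel₀ _ (Real.Gamma_pos_of_pos hn).ne']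

/-- Averaging a continuous logarithm over `(0, 1)` yields a continuous logarithm. -/
theorem IsContinuousLog.average (hψ : IsContinuousLog φ ψ) (f : ℝ → ℝ)
    [IsFiniteMeasure (unitDensity f)] {φ' : ℂ → ℂ}
    (hφ' : ∀ u : ℂ, 0 ≤ u.re →
      φ' u = Complex.exp (∫ v, ψ ((v : ℂ) * u) ∂unitDensity f)) :
    IsContinuousLog φ' fun u => ∫ v, ψ ((v : ℂ) * u) ∂unitDensity f := by
  refine ⟨fun u hu => ?_, by simp [hψ.map_zero], fun u hu => (hφ' u hu).symm⟩
  -- Multiplication by `v ∈ [0,1]` keeps points within distance `1` of `u` inside this compact set,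
  -- which supplies a uniform dominating constant.
  have hK : IsCompact ({u : ℂ | 0 ≤ u.re} ∩ Metric.closedBall 0 (‖u‖ + 1)) :=
    (isCompact_closedBall _ _).inter_left (isClosed_le continuous_const Complex.continuous_re)
  obtain ⟨C, hC⟩ := hK.exists_bound_of_continuousOn (hψ.continuousOn.mono inter_subset_left)
  refine continuousWithinAt_of_dominated (bound := fun _ => C) ?_ ?_ (integrable_const _) ?_
  · filter_upwards [self_mem_nhdsWithin] with w hw
    exact (integrable_ray_unitDensity hψ hw f).aestronglyMeasurable
  · filter_upwards [self_mem_nhdsWithin,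
      mem_nhdsWithin_of_mem_nhds (Metric.ball_mem_nhds u one_pos)] with w hw1 hw2
    filter_upwards [ae_unitDensity_mem_Icc f] with v hv
    refine hC _ ⟨by simpa using mul_nonneg hv.1 hw1, ?_⟩
    rw [mem_closedBall_zero_iff, norm_mul, Complex.norm_real, Real.norm_eq_abs, abs_of_nonneg hv.1]
    have h1 : ‖w‖ ≤ ‖u‖ + 1 := by
      rw [Metric.mem_ball, dist_eq_norm] at hw2
      linarith [norm_le_norm_add_norm_sub' w u]
    nlinarith [hv.2, hv.1, norm_nonneg w]
  · filter_upwards [ae_unitDensity_mem_Icc f] with v hv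
    refine ContinuousWithinAt.comp (t := {u : ℂ | 0 ≤ u.re}) (hψ.continuousOn _ ?_) (by fun_prop)
      fun w hw => ?_
    · simpa using mul_nonneg hv.1 hu
    · simpa using mul_nonneg hv.1 hw

end Exponents

/-! ### Averages of real degree as weighted averages over the unit interval -/

section Paths

variable {Ω : Type u} (X : ℝ≥0 → Ω → ℝ)

theorem runningAverage_eq {t : ℝ≥0} (ht : 0 < t) (ω : Ω) :
    runningAverage X t ω = ∫ s in (0 : ℝ)..1, X ((t : ℝ) * s).toNNReal ω := by
  have ht' : (t : ℝ) ≠ 0 := by exact_mod_cast ht.ne'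
  rw [intervalIntegral.integral_comp_mul_left (fun s => X s.toNNReal ω) ht', mul_zero, mul_one,
    runningAverage, smul_eq_mul, one_div]

theorem fracAverageI_eq {n : ℝ} (hn : 0 < n) {t : ℝ≥0} (ht : 0 < t) (ω : Ω) :
    fracAverageI X n t ω =
      ∫ s, X ((t : ℝ) * s).toNNReal ω ∂unitDensity (logGammaDensity n) := by
  have ht' : (t : ℝ) ≠ 0 := by exact_mod_cast ht.ne'
  have h := intervalIntegral.integral_comp_mul_left (a := 0) (b := 1)
    (fun s => X s.toNNReal ω * Real.log (t / s) ^ (n - 1)) ht'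
  rw [mul_zero, mul_one, smul_eq_mul] at h
  rw [integral_unitDensity (measurable_logGammaDensity n)
    (fun v hv => logGammaDensity_nonneg hn hv), fracAverageI, one_div, mul_inv, mul_right_comm, ← h,
    mul_comm, ← intervalIntegral.integral_const_mul]
  refine intervalIntegral_congr_Ioo zero_le_one fun s hs => ?_
  rw [div_mul_cancel_left₀ ht', Real.log_inv, logGammaDensity, smul_eq_mul]
  ring

/-- The density of the type-III average on the unit interval. -/
noncomputable def quasiDensity (n s : ℝ) : ℝ :=
  (1 - s) ^ (n - 1) / Real.Gamma n

theorem measurable_quasiDensity (n : ℝ) : Measurable (quasiDensity n) := by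
  unfold quasiDensity
  fun_prop

theorem quasiDensity_nonneg {n : ℝ} (hn : 0 < n) {s : ℝ} (hs : s ∈ Ioo (0 : ℝ) 1) :
    0 ≤ quasiDensity n s :=
  div_nonneg (Real.rpow_nonneg (by linarith [hs.2]) _) (Real.Gamma_pos_of_pos hn).le

theorem fracAverageIII_eq {n : ℝ} (hn : 0 < n) {t : ℝ≥0} (ht : 0 < t) (ω : Ω) :
    fracAverageIII X n t ω = ∫ s, X ((t : ℝ) * s).toNNReal ω ∂unitDensity (quasiDensity n) := by
  have ht' : (0 : ℝ) < t := by exact_mod_cast ht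
  have h := intervalIntegral.integral_comp_mul_left (a := 0) (b := 1)
    (fun s => ((t : ℝ) - s) ^ (n - 1) * X s.toNNReal ω) ht'.ne'
  rw [mul_zero, mul_one, smul_eq_mul, eq_inv_mul_iff_mul_eq₀ ht'.ne'] at h
  rw [integral_unitDensity (measurable_quasiDensity n) (fun v hv => quasiDensity_nonneg hn hv),
    fracAverageIII, ← h, ← mul_assoc, ← intervalIntegral.integral_const_mul]
  refine intervalIntegral_congr_Ioo zero_le_one fun s hs => ?_
  have h1 : ((t : ℝ) - t * s) ^ (n - 1) = t ^ (n - 1) * (1 - s) ^ (n - 1) := by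
    rw [← Real.mul_rpow ht'.le (by linarith [hs.2])]
    congr 1
    ring
  have h2 : (t : ℝ) ^ n = t ^ (n - 1) * t := by
    rw [← Real.rpow_add_one ht'.ne', sub_add_cancel]
  have h3 := (Real.rpow_pos_of_pos ht' (n - 1)).ne'
  have h4 := (Real.Gamma_pos_of_pos hn).ne'
  rw [h1, h2, quasiDensity, smul_eq_mul]
  field_simp

theorem unitDensity_quasiDensity_Ioi {n : ℝ} (hn : 0 < n) {s : ℝ} (hs : s ∈ Icc (0 : ℝ) 1) :
    unitDensity (quasiDensity n) (Ioi s) = ENNReal.ofReal ((1 - s) ^ n / Real.Gamma (n + 1)) := by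
  have hint : IntervalIntegrable (quasiDensity n) volume s 1 := by
    have h := (intervalIntegral.intervalIntegrable_rpow' (r := n - 1) (by linarith)
      (a := 1 - s) (b := 0)).comp_sub_left 1
    simp only [sub_sub_cancel, sub_zero] at h
    exact h.div_const _
  have h5 : Ioi s ∩ Ioo 0 1 = Ioo s 1 := by
    ext x
    simp only [mem_inter_iff, mem_Ioi, mem_Ioo]
    exact ⟨fun h => ⟨h.1, h.2.2⟩, fun h => ⟨h.1, hs.1.trans_lt h.1, h.2⟩⟩
  rw [unitDensity, withDensity_apply _ measurableSet_Ioi, Measure.restrict_restrict measurableSet_Ioi,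
    h5, ← ofReal_integral_eq_lintegral_ofReal
      ((intervalIntegrable_iff_integrableOn_Ioo_of_le hs.2).1 hint) ?_]
  · rw [← integral_Ioc_eq_integral_Ioo, ← intervalIntegral.integral_of_le hs.2]
    congr 1
    unfold quasiDensity
    rw [intervalIntegral.integral_div,
      intervalIntegral.integral_comp_sub_left (fun x : ℝ => x ^ (n - 1)) 1, sub_self,
      integral_rpow (Or.inl (by linarith)), sub_add_cancel, Real.zero_rpow hn.ne', sub_zero,
      Real.Gamma_add_one hn.ne', div_div]
  · filter_upwards [ae_restrict_mem measurableSet_Ioo] with x hx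
    exact quasiDensity_nonneg hn ⟨hs.1.trans_lt hx.1, hx.2⟩

/-- The mass is `1/Γ(n+1)`, in general not `1`; hence the general formula is needed for finite
measures rather than probability measures. -/
theorem isFiniteMeasure_quasiDensity {n : ℝ} (hn : 0 < n) :
    IsFiniteMeasure (unitDensity (quasiDensity n)) := by
  constructor
  have h : unitDensity (quasiDensity n) univ = unitDensity (quasiDensity n) (Ioi 0) := by
    refine measure_congr (eventuallyEq_set.2 ?_)
    filter_upwards [ae_unitDensity_mem_Ioo (quasiDensity n)] with s hs
    simp [hs.1]
  rw [h, unitDensity_quasiDensity_Ioi hn ⟨le_rfl, zero_le_one⟩]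
  exact ENNReal.ofReal_lt_top

end Paths

/-! ### Laplace transforms of the averages -/

namespace IsLevySubordinator

variable {Ω : Type u} [MeasurableSpace Ω] {P : Measure Ω} {X : ℝ≥0 → Ω → ℝ}
  [IsProbabilityMeasure P] {ψ : ℂ → ℂ}

theorem laplaceTransform_fracAverageI (hX : IsLevySubordinator P X)
    (hψ : IsContinuousLog (laplaceTransform P (X 1)) ψ) {n : ℝ} (hn : 0 < n) {t : ℝ≥0}
    (ht : 0 < t) {u : ℂ} (hu : 0 ≤ u.re) :
    laplaceTransform P (fracAverageI X n t) u = formulaI ψ n t u := by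
  have := isProbabilityMeasure_logGamma hn
  rw [funext (fracAverageI_eq X hn ht), hX.laplaceTransform_integral hψ _
    (ae_unitDensity_mem_Icc _) t hu, formulaI]
  congr 2
  refine intervalIntegral_congr_Ioo zero_le_one fun s hs => ?_
  rw [logGamma_Ioi hn hs, integrandI]

/-- The average integrates the path against the image `μ` of Lebesgue measure under the decreasing
kernel `k`. The tail of `μ` at `k(v)` is `v`, so the substitution `s = k(v)` turns the general
exponent into the type-II one. -/
theorem laplaceTransform_fracAverageII (hX : IsLevySubordinator P X)
    (hψ : IsContinuousLog (laplaceTransform P (X 1)) ψ) {n : ℝ} (hn : 0 < n) (t : ℝ≥0)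
    {u : ℂ} (hu : 0 ≤ u.re) :
    laplaceTransform P (fracAverageII X n t) u = formulaII ψ n t u := by
  have hk : AEMeasurable (gammaKernel n) (volume.restrict (Ioo (0 : ℝ) 1)) :=
    ContinuousOn.aemeasurable
      (fun s hs => (hasDerivAt_gammaKernel hn hs).continuousAt.continuousWithinAt) measurableSet_Ioo
  set μ := (volume.restrict (Ioo (0 : ℝ) 1)).map (gammaKernel n) with hμ
  have hμ1 : ∀ᵐ s ∂μ, s ∈ Icc (0 : ℝ) 1 := by
    refine (ae_map_iff hk measurableSet_Icc).2 ?_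
    filter_upwards [ae_restrict_mem measurableSet_Ioo] with s hs
    exact Ioo_subset_Icc_self (gammaKernel_mem_Ioo hn hs)
  have hμ2 : ∀ v ∈ Ioo (0 : ℝ) 1, μ.real (Ioi (gammaKernel n v)) = v := by
    intro v hv
    have h1 : gammaKernel n ⁻¹' Ioi (gammaKernel n v) ∩ Ioo 0 1 = Ioo 0 v := by
      ext x
      simp only [mem_inter_iff, mem_preimage, mem_Ioi]
      refine ⟨fun h => ⟨h.2.1, ((strictAntiOn_gammaKernel hn).lt_iff_gt hv h.2).1 h.1⟩, fun h => ?_⟩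
      have hx : x ∈ Ioo (0 : ℝ) 1 := ⟨h.1, h.2.trans hv.2⟩
      exact ⟨strictAntiOn_gammaKernel hn hx hv h.2, hx⟩
    rw [measureReal_def, hμ, Measure.map_apply_of_aemeasurable hk measurableSet_Ioi,
      Measure.restrict_apply' measurableSet_Ioo, h1, Real.volume_Ioo, sub_zero,
      ENNReal.toReal_ofReal hv.1.le]
  have h1 : fracAverageII X n t =ᵐ[P] fun ω => ∫ s, X ((t : ℝ) * s).toNNReal ω ∂μ := by
    filter_upwards [hX.ae_monotone] with ω hω
    have hmono : Monotone fun s : ℝ => X ((t : ℝ) * s).toNNReal ω := fun a b hab =>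
      hω (Real.toNNReal_le_toNNReal (mul_le_mul_of_nonneg_left hab t.2))
    rw [hμ, integral_map hk hmono.measurable.aestronglyMeasurable, fracAverageII,
      intervalIntegral.integral_of_le zero_le_one, integral_Ioc_eq_integral_Ioo]
  rw [laplaceTransform_congr h1, hX.laplaceTransform_integral hψ μ hμ1 t hu, formulaII_eq hn,
    integral_unitDensity (measurable_logGammaDensity n) (fun v hv => logGammaDensity_nonneg hn hv),
    integral_comp_gammaKernel hn]
  congr 2
  refine intervalIntegral_congr_Ioo zero_le_one fun v hv => ?_
  rw [hμ2 v hv]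

theorem laplaceTransform_fracAverageIII (hX : IsLevySubordinator P X)
    (hψ : IsContinuousLog (laplaceTransform P (X 1)) ψ) {n : ℝ} (hn : 0 < n) {t : ℝ≥0}
    (ht : 0 < t) {u : ℂ} (hu : 0 ≤ u.re) :
    laplaceTransform P (fracAverageIII X n t) u = formulaIII ψ n t u := by
  have := isFiniteMeasure_quasiDensity hn
  rw [funext (fracAverageIII_eq X hn ht), hX.laplaceTransform_integral hψ _
    (ae_unitDensity_mem_Icc _) t hu, formulaIII]
  -- The tail is a power of `1 - s`; reflecting the interval gives the power of `s` in the formula.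
  have h := intervalIntegral.integral_comp_sub_left (a := 0) (b := 1) (integrandIII ψ n u) 1
  rw [sub_self, sub_zero] at h
  rw [← h]
  congr 2
  refine intervalIntegral_congr_Ioo zero_le_one fun s hs => ?_
  rw [measureReal_def, unitDensity_quasiDensity_Ioi hn (Ioo_subset_Icc_self hs),
    ENNReal.toReal_ofReal (div_nonneg (Real.rpow_nonneg (by linarith [hs.2]) _)
      (Real.Gamma_pos_of_pos (by linarith)).le), integrandIII]
  push_cast
  congr 1
  ring

theorem laplaceTransform_runningAverage (hX : IsLevySubordinator P X)
    (hψ : IsContinuousLog (laplaceTransform P (X 1)) ψ) {t : ℝ≥0} (ht : 0 < t) {u : ℂ}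
    (hu : 0 ≤ u.re) :
    laplaceTransform P (runningAverage X t) u =
      Complex.exp ((t : ℝ) * ∫ s in (0 : ℝ)..1, ψ ((s : ℂ) * u)) := by
  have h1 : runningAverage X t = fracAverageIII X 1 t := by
    funext ω
    simp [runningAverage, fracAverageIII]
  rw [h1, hX.laplaceTransform_fracAverageIII hψ one_pos ht hu, formulaIII]
  simp [integrandIII, one_add_one_eq_two]

theorem laplaceTransform_runningAverage_eq_formulaII_one (hX : IsLevySubordinator P X)
    (hψ : IsContinuousLog (laplaceTransform P (X 1)) ψ) {t : ℝ≥0} (ht : 0 < t) {u : ℂ}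
    (hu : 0 ≤ u.re) :
    laplaceTransform P (runningAverage X t) u = formulaII ψ 1 t u := by
  rw [hX.laplaceTransform_runningAverage hψ ht hu, formulaII]
  simp [integrandII, mul_comm]

/-- The running average of a Lévy subordinator whose exponent is the type-II exponent of degree
`n` has the type-II exponent of degree `n + 1`. -/
theorem laplaceTransform_runningAverage_of_formulaII {φ : ℂ → ℂ} (hψ : IsContinuousLog φ ψ)
    {n : ℝ} (hn : 0 < n) {Y : ℝ≥0 → Ω → ℝ} (hY : IsLevySubordinator P Y)
    (h1 : ∀ u : ℂ, 0 ≤ u.re → laplaceTransform P (Y 1) u = formulaII ψ n 1 u) {t : ℝ≥0}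
    (ht : 0 < t) {u : ℂ} (hu : 0 ≤ u.re) :
    laplaceTransform P (runningAverage Y t) u = formulaII ψ (n + 1) t u := by
  have := isProbabilityMeasure_logGamma hn
  have := isProbabilityMeasure_logGamma (n := n + 1) (by linarith)
  -- The averaged exponent is itself the continuous logarithm for `Y`, so the running-average
  -- formula applies to `Y`; the resulting double average of `ψ` collapses to degree `n+1`.
  have hχ := hψ.average (logGammaDensity n) (φ' := laplaceTransform P (Y 1)) fun u hu => by
    rw [h1 u hu, formulaII_eq hn]
    simp
  rw [hY.laplaceTransform_runningAverage hχ ht hu, formulaII_eq (by linarith),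
    ← integral_integral_mul_logGamma hn (integrable_ray_unitDensity hψ hu _)]
  congr 2
  refine intervalIntegral.integral_congr fun s _ => ?_
  congr 1
  funext v
  congr 1
  push_cast
  ring

end IsLevySubordinator

theorem IsTypeIIClock.laplaceTransform_runningAverage {Ω : Type u} [MeasurableSpace Ω]
    {P : Measure Ω} [hP : IsProbabilityMeasure P] {X : ℝ≥0 → Ω → ℝ} (hX : IsLevySubordinator P X)
    {ψ : ℂ → ℂ} (hψ : IsContinuousLog (laplaceTransform P (X 1)) ψ) {m : ℕ} {Ω' : Type u}
    [MeasurableSpace Ω'] {Q : Measure Ω'} {Y : ℝ≥0 → Ω' → ℝ} (hY : IsTypeIIClock P X m Q Y)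
    {t : ℝ≥0} (ht : 0 < t) {u : ℂ} (hu : 0 ≤ u.re) :
    laplaceTransform Q (runningAverage Y t) u = formulaII ψ ((m : ℝ) + 1) t u := by
  induction hY generalizing t u with
  | zero => simpa using hX.laplaceTransform_runningAverage_eq_formulaII_one hψ ht hu
  | succ Q₁ Q₂ Y₁ Y₂ _ levy marginals ih =>
    push_cast
    refine levy.laplaceTransform_runningAverage_of_formulaII hψ (by positivity) (fun v hv => ?_) ht hu
    -- The marginal at time `1` suffices, since it determines the exponent of a Lévy subordinator.
    rw [laplaceTransform_identDistrib (marginals 1), ih one_pos hv]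

/-! ### The real-degree averages extend the recipes -/

section Recipes

variable {Ω : Type u} {X : ℝ≥0 → Ω → ℝ} {ω : Ω}

/-- Each further running average multiplies the random time fraction by an independent uniform
factor, raising the log-gamma degree by one. Monotonicity bounds the path by its value at `t`, which
gives integrability. -/
theorem repeatedAverage_eq (hmono : Monotone fun t => X t ω) (h0 : X 0 ω = 0) (n : ℕ) {t : ℝ≥0}
    (ht : 0 < t) : repeatedAverage X (n + 1) t ω =
      ∫ s, X ((t : ℝ) * s).toNNReal ω ∂unitDensity (logGammaDensity (n + 1)) := by
  induction n generalizing t with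
  | zero =>
    rw [integral_unitDensity (measurable_logGammaDensity _)
      (fun v hv => logGammaDensity_nonneg (by simp) hv)]
    simp only [Nat.cast_zero, zero_add, logGammaDensity_one, one_smul]
    exact runningAverage_eq _ ht ω
  | succ n ih =>
    have hn : (0 : ℝ) < (n : ℝ) + 1 := by positivity
    have := isProbabilityMeasure_logGamma (n := (n : ℝ) + 1 + 1) (by positivity)
    have hm : Monotone fun s : ℝ => X ((t : ℝ) * s).toNNReal ω := fun a b hab =>
      hmono (Real.toNNReal_le_toNNReal (mul_le_mul_of_nonneg_left hab t.2))
    have hint : Integrable (fun s : ℝ => X ((t : ℝ) * s).toNNReal ω)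
        (unitDensity (logGammaDensity ((n : ℝ) + 1 + 1))) := by
      refine Integrable.mono' (integrable_const (X t ω)) hm.measurable.aestronglyMeasurable ?_
      filter_upwards [ae_unitDensity_mem_Icc _] with s hs
      rw [Real.norm_eq_abs, abs_of_nonneg (h0.symm.le.trans (hmono (by simp)))]
      refine hmono ?_
      rw [Real.toNNReal_le_iff_le_coe]
      exact mul_le_of_le_one_right t.2 hs.2
    rw [repeatedAverage, runningAverage_eq _ ht, Nat.cast_add_one,
      ← integral_integral_mul_logGamma hn hint]
    refine intervalIntegral_congr_Ioo zero_le_one fun s hs => ?_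
    have hts : 0 < (t : ℝ) * s := mul_pos (by exact_mod_cast ht) hs.1
    rw [ih (Real.toNNReal_pos.2 hts), Real.coe_toNNReal _ hts.le]
    simp only [mul_assoc]

/-- Interchange of the integrals in the iterated Riemann–Liouville integral. -/
theorem integral_integral_sub_pow_mul {f : ℝ → ℝ} (hf : Measurable f) {t C : ℝ} (ht : 0 ≤ t)
    (hC : ∀ r ∈ Ioc 0 t, |f r| ≤ C) (m : ℕ) :
    ∫ s in (0 : ℝ)..t, ∫ r in (0 : ℝ)..s, (s - r) ^ m * f r =
      ∫ r in (0 : ℝ)..t, (t - r) ^ (m + 1) / (m + 1) * f r := by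
  set ν : Measure ℝ := volume.restrict (Ioc 0 t) with hν
  -- Extending the integrand by zero from the triangle `r < s` to the square puts the integral in
  -- product form for Fubini.
  set F : ℝ → ℝ → ℝ := fun s r => (Iio s).indicator (fun r => (s - r) ^ m * f r) r with hF
  have hFm : Measurable (Function.uncurry F) := by
    have : Function.uncurry F = {p : ℝ × ℝ | p.2 < p.1}.indicator
        fun p => (p.1 - p.2) ^ m * f p.2 := by
      funext p
      simp only [hF, Function.uncurry, indicator_apply, mem_Iio, mem_ofPred_eq]
    rw [this]
    exact Measurable.indicator (by fun_prop) (measurableSet_lt measurable_snd measurable_fst)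
  have hint : Integrable (Function.uncurry F) (ν.prod ν) := by
    refine Integrable.mono' (integrable_const (t ^ m * C)) hFm.aestronglyMeasurable ?_
    rw [hν, Measure.prod_restrict]
    filter_upwards [ae_restrict_mem (measurableSet_Ioc.prod measurableSet_Ioc)] with p hp
    have hC0 : 0 ≤ C := (abs_nonneg _).trans (hC p.2 hp.2)
    simp only [Function.uncurry, hF]
    by_cases h : p.2 < p.1
    · rw [indicator_of_mem (mem_Iio.2 h), norm_mul, norm_pow, Real.norm_eq_abs, Real.norm_eq_abs]
      have h1 : |p.1 - p.2| ≤ t := by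
        rw [abs_of_pos (sub_pos.2 h)]
        linarith [hp.1.2, hp.2.1]
      have := hC p.2 hp.2
      gcongr
    · rw [indicator_of_notMem (by simpa using h), norm_zero]
      positivity
  have h1 : ∀ s ∈ Ioc 0 t, ∫ r in (0 : ℝ)..s, (s - r) ^ m * f r = ∫ r, F s r ∂ν := by
    intro s hs
    rw [intervalIntegral.integral_of_le hs.1.le, integral_Ioc_eq_integral_Ioo, hν,
      integral_indicator measurableSet_Iio, Measure.restrict_restrict measurableSet_Iio]
    congr 2
    ext x
    simp only [mem_inter_iff, mem_Iio, mem_Ioo, mem_Ioc]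
    exact ⟨fun h => ⟨h.2, h.1, h.2.le.trans hs.2⟩, fun h => ⟨h.2.1, h.1⟩⟩
  have h2 : ∀ r ∈ Ioc 0 t, ∫ s, F s r ∂ν = (t - r) ^ (m + 1) / (m + 1) * f r := by
    intro r hr
    have h3 : ∀ s, F s r = (Ioi r).indicator (fun s => (s - r) ^ m * f r) s := by
      intro s
      simp only [hF, indicator_apply, mem_Iio, mem_Ioi]
    have h4 : Ioi r ∩ Ioc 0 t = Ioc r t := by
      ext x
      simp only [mem_inter_iff, mem_Ioi, mem_Ioc]
      exact ⟨fun h => ⟨h.1, h.2.2⟩, fun h => ⟨h.1, hr.1.trans h.1, h.2⟩⟩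
    simp only [h3]
    rw [hν, integral_indicator measurableSet_Ioi, Measure.restrict_restrict measurableSet_Ioi, h4,
      ← intervalIntegral.integral_of_le hr.2, intervalIntegral.integral_mul_const,
      intervalIntegral.integral_comp_sub_right (fun x : ℝ => x ^ m), integral_pow, sub_self]
    simp
  rw [intervalIntegral.integral_of_le ht, intervalIntegral.integral_of_le ht,
    setIntegral_congr_fun measurableSet_Ioc h1, ← setIntegral_congr_fun measurableSet_Ioc h2]
  exact integral_integral_swap hint

/-- Cauchy's formula for repeated integration, proved path by path; monotonicity from `0` supplies
measurability and the bound that Fubini requires. -/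
theorem iteratedIntegral_eq (hmono : Monotone fun t => X t ω) (h0 : X 0 ω = 0) (m : ℕ) (t : ℝ≥0) :
    iteratedIntegral X (m + 1) t ω =
      1 / (m.factorial : ℝ) * ∫ s in (0 : ℝ)..t, ((t : ℝ) - s) ^ m * X s.toNNReal ω := by
  induction m generalizing t with
  | zero => simp [iteratedIntegral]
  | succ m ih =>
    have hm : Monotone fun s : ℝ => X s.toNNReal ω := fun a b hab =>
      hmono (Real.toNNReal_le_toNNReal hab)
    have hC : ∀ r ∈ Ioc 0 (t : ℝ), |X r.toNNReal ω| ≤ X t ω := by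
      intro r hr
      rw [abs_of_nonneg (h0.symm.le.trans (hmono (by simp)))]
      exact hmono (Real.toNNReal_le_iff_le_coe.2 hr.2)
    have h1 : ∫ s in (0 : ℝ)..t, iteratedIntegral X (m + 1) s.toNNReal ω =
        ∫ s in (0 : ℝ)..t, 1 / (m.factorial : ℝ) *
          ∫ r in (0 : ℝ)..s, (s - r) ^ m * X r.toNNReal ω := by
      refine intervalIntegral_congr_Ioo t.2 fun s hs => ?_
      rw [ih, Real.coe_toNNReal _ hs.1.le]
    change ∫ s in (0 : ℝ)..t, iteratedIntegral X (m + 1) s.toNNReal ω = _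
    rw [h1, intervalIntegral.integral_const_mul,
      integral_integral_sub_pow_mul hm.measurable t.coe_nonneg hC m, ← intervalIntegral.integral_const_mul,
      ← intervalIntegral.integral_const_mul]
    refine intervalIntegral_congr_Ioo t.2 fun s _ => ?_
    rw [Nat.factorial_succ]
    push_cast
    have : (m.factorial : ℝ) ≠ 0 := by positivity
    field_simp

theorem quasiAverage_eq_fracAverageIII (hmono : Monotone fun t => X t ω) (h0 : X 0 ω = 0) (m : ℕ)
    (t : ℝ≥0) : quasiAverage X (m + 1) t ω = fracAverageIII X (m + 1 : ℕ) t ω := by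
  rw [quasiAverage, iteratedIntegral_eq hmono h0, fracAverageIII, Nat.cast_add_one,
    add_sub_cancel_right, Real.Gamma_nat_eq_factorial, ← Nat.cast_add_one]
  simp only [Real.rpow_natCast]
  rw [← mul_assoc, one_div_mul_one_div]

end Recipes

theorem theorem1 {Ω : Type u} [MeasurableSpace Ω] (P : Measure Ω) [IsProbabilityMeasure P]
    (X : ℝ≥0 → Ω → ℝ) (hX : IsLevySubordinator P X) :
    -- the logarithm of the Laplace transform of `X 1` exists
    (∃ ψ : ℂ → ℂ, IsContinuousLog (laplaceTransform P (X 1)) ψ) ∧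
    ∀ ψ : ℂ → ℂ, IsContinuousLog (laplaceTransform P (X 1)) ψ →
      -- the integrals on the right-hand sides converge
      (∀ n : ℝ, 0 < n → ∀ u : ℂ, 0 ≤ u.re →
        IntervalIntegrable (integrandI ψ n u) volume 0 1 ∧
        IntervalIntegrable (integrandII ψ n u) volume 0 1 ∧
        IntervalIntegrable (integrandIII ψ n u) volume 0 1) ∧
      -- integer degrees: the three recipes
      (∀ n : ℕ, 1 ≤ n → ∀ t : ℝ≥0, 0 < t → ∀ u : ℂ, 0 ≤ u.re →
        laplaceTransform P (repeatedAverage X n t) u = formulaI ψ n t u ∧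
        (∀ m : ℕ, m + 1 = n → ∀ (Ω' : Type u) [MeasurableSpace Ω'] (Q : Measure Ω')
          [IsProbabilityMeasure Q] (Y : ℝ≥0 → Ω' → ℝ), IsTypeIIClock P X m Q Y →
          laplaceTransform Q (runningAverage Y t) u = formulaII ψ n t u) ∧
        laplaceTransform P (quasiAverage X n t) u = formulaIII ψ n t u) ∧
      -- real degrees
      (∀ n : ℝ, 0 < n → ∀ t : ℝ≥0, 0 < t → ∀ u : ℂ, 0 ≤ u.re →
        laplaceTransform P (fracAverageI X n t) u = formulaI ψ n t u ∧
        laplaceTransform P (fracAverageII X n t) u = formulaII ψ n t u ∧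
        laplaceTransform P (fracAverageIII X n t) u = formulaIII ψ n t u) ∧
      -- the real-degree averages extend the recipes
      (∀ n : ℕ, 1 ≤ n → ∀ᵐ ω ∂P, ∀ t : ℝ≥0, 0 < t →
        repeatedAverage X n t ω = fracAverageI X n t ω ∧
        quasiAverage X n t ω = fracAverageIII X n t ω) ∧
      (∀ n : ℝ, 0 < n → ∀ (Ω' : Type u) [MeasurableSpace Ω'] (Q : Measure Ω')
        [IsProbabilityMeasure Q] (Y : ℝ≥0 → Ω' → ℝ), IsLevySubordinator Q Y →
        (∀ t : ℝ≥0, IdentDistrib (Y t) (fracAverageII X n t) Q P) →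
        ∀ t : ℝ≥0, 0 < t → ∀ u : ℂ, 0 ≤ u.re →
          laplaceTransform Q (runningAverage Y t) u = formulaII ψ (n + 1) t u) := by

  -- The exceptional set is where the path fails to be monotone from `0`, so it does not depend on
  -- `t`. The integer formulas of types I and III then follow from the real-degree ones.
  have hextend : ∀ n : ℕ, 1 ≤ n → ∀ᵐ ω ∂P, ∀ t : ℝ≥0, 0 < t →
      repeatedAverage X n t ω = fracAverageI X n t ω ∧
      quasiAverage X n t ω = fracAverageIII X n t ω := by
    intro n hn
    obtain ⟨m, rfl⟩ := Nat.exists_eq_add_of_le' hn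
    filter_upwards [hX.ae_monotone, hX.start_zero] with ω h1 h2 t ht
    refine ⟨?_, quasiAverage_eq_fracAverageIII h1 h2 m t⟩
    rw [repeatedAverage_eq h1 h2 m ht, Nat.cast_add_one, fracAverageI_eq X (by positivity) ht]
  refine ⟨?_, fun ψ hψ => ⟨fun n hn u hu => ⟨intervalIntegrable_integrandI hψ hn hu,
    intervalIntegrable_integrandII hψ hn hu, intervalIntegrable_integrandIII hψ hn hu⟩, ?_,
    fun n hn t ht u hu => ⟨hX.laplaceTransform_fracAverageI hψ hn ht hu,
      hX.laplaceTransform_fracAverageII hψ hn t hu,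
      hX.laplaceTransform_fracAverageIII hψ hn ht hu⟩, hextend, ?_⟩⟩
  · obtain ⟨ψ, hψ, -⟩ := hX.exists_laplaceExponent
    exact ⟨ψ, hψ⟩
  · intro n hn t ht u hu
    have hn' : (0 : ℝ) < n := by exact_mod_cast hn
    refine ⟨?_, ?_, ?_⟩
    · rw [laplaceTransform_congr ((hextend n hn).mono fun ω h => (h t ht).1)]
      exact hX.laplaceTransform_fracAverageI hψ hn' ht hu
    · rintro m rfl Ω' _ Q _ Y hY
      rw [Nat.cast_add_one]
      exact hY.laplaceTransform_runningAverage hX hψ ht hu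
    · rw [laplaceTransform_congr ((hextend n hn).mono fun ω h => (h t ht).2)]
      exact hX.laplaceTransform_fracAverageIII hψ hn' ht hu
  · intro n hn Ω' _ Q _ Y hY hYX t ht u hu
    refine hY.laplaceTransform_runningAverage_of_formulaII hψ hn (fun v hv => ?_) ht hu
    rw [laplaceTransform_identDistrib (hYX 1), hX.laplaceTransform_fracAverageII hψ hn 1 hv]
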